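/- A binary data element (BDE) is a pair $(X,Y)$ of random variables on a common probability space, where $X$ takes values in $\{0,1\}$ (identified with the field $\mathbb F_2$; not necessarily uniform) and $Y$ takes values in an arbitrary measurable space. Its conditional entropy random variable is $h(X|Y)=-\log_2 p_{X|Y}(X|Y)$, and its varentropy is $V(X|Y)=\operatorname{Var}(h(X|Y))$. Let $(X,Y)$ be a BDE. For each $n$ let $N=2^n$ and let $(X_1,Y_1),\dots,(X_N,Y_N)$ be i.i.d. copies of $(X,Y)$. Put $\mathbf Y=(Y_1,\dots,Y_N)$ and $$\mathbf U=(U_1,\dots,U_N)=(X_1,\dots,X_N)\,F^{\otimes n},\qquad F=\begin{pmatrix}1&0\\1&1\end{pmatrix},$$ where the arithmetic is over $\mathbb F_2$ and $F^{\otimes n}$ is the $n$-th Kronecker power; write $\mathbf U^{i-1}=(U_1,\dots,U_{i-1})$. Then all the random variables $h(U_i|\mathbf U^{i-1},\mathbf Y)$ are square-integrable (so the varentropies below are well defined and finite), and the average varentropy at the output of the polar transform vanishes asymptotically: $$\frac1N\sum_{i=1}^N V(U_i\,|\,\mathbf U^{i-1},\mathbf Y)\;\longrightarrow\;0\qquad\text{as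 } N=2^n\to\infty .$$ -/

import Mathlib

open MeasureTheory ProbabilityTheory Filter
open scoped Topology Kronecker

noncomputable section

namespace Polar

/-- The conditional entropy random variable `h(X|Y) = -log₂ p_{X|Y}(X|Y)` of a binary data
element `(X, Y)`, where `X` takes values in `{0,1} = ZMod 2`. The conditional probability of `{X = x}` given `Y` is the conditional
expectation of its indicator given the `σ`-algebra generated by `Y`. -/
def entropyRV {Ω 𝓨 : Type*} [MeasurableSpace Ω] [MeasurableSpace 𝓨] (μ : Measure Ω)
    (X : Ω → ZMod 2) (Y : Ω → 𝓨) : Ω → ℝ :=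
  fun ω => -Real.logb 2
    ((μ⟦X ⁻¹' {X ω} | MeasurableSpace.comap Y inferInstance⟧ : Ω → ℝ) ω)

/-- The varentropy `V(X|Y) = Var(h(X|Y))`. -/
def varentropy {Ω 𝓨 : Type*} [MeasurableSpace Ω] [MeasurableSpace 𝓨] (μ : Measure Ω)
    (X : Ω → ZMod 2) (Y : Ω → 𝓨) : ℝ :=
  variance (entropyRV μ X Y) μ

/-- The kernel `F = [1 0; 1 1]` over the field with two elements. -/
def kernelMatrix : Matrix (Fin 2) (Fin 2) (ZMod 2) := !![1, 0; 1, 1]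

/-- The Kronecker power `F^{⊗ n}`, a square matrix of size `2 ^ n`, with the usual
lexicographic indexing of Kronecker products: `F^{⊗ (n+1)} = F ⊗ F^{⊗ n}`. -/
def polarMatrix : (n : ℕ) → Matrix (Fin (2 ^ n)) (Fin (2 ^ n)) (ZMod 2)
  | 0 => 1
  | n + 1 =>
    let e : Fin 2 × Fin (2 ^ n) ≃ Fin (2 ^ (n + 1)) :=
      finProdFinEquiv.trans (finCongr (pow_succ' 2 n).symm)
    Matrix.reindex e e (kernelMatrix ⊗ₖ polarMatrix n)

/-- The random row vector `U = X · F^{⊗ n}`; `output X i` is the bit `U_i`. -/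
def output {Ω : Type*} {n : ℕ} (X : Fin (2 ^ n) → Ω → ZMod 2) (i : Fin (2 ^ n)) :
    Ω → ZMod 2 :=
  fun ω => Matrix.vecMul (fun j => X j ω) (polarMatrix n) i

/-- The side information `(U_1, …, U_{i-1}, Y_1, …, Y_N)` of the `i`-th output binary data
element. -/
def outputSide {Ω 𝓨 : Type*} {n : ℕ} (X : Fin (2 ^ n) → Ω → ZMod 2)
    (Y : Fin (2 ^ n) → Ω → 𝓨) (i : Fin (2 ^ n)) :
    Ω → ({j : Fin (2 ^ n) // j < i} → ZMod 2) × (Fin (2 ^ n) → 𝓨) :=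
  fun ω => (fun j => output X j ω, fun j => Y j ω)

end Polar

end

/-! Polarization is tracked by the Bhattacharyya parameter `z`, which controls varentropy from both
ends: the second moment of the entropy variable about `0` is O(`z`) and about `1` is O(`1 - z`), so
the varentropy is at most a constant times `z * (1 - z)` (`varentropy_le`).

One polar step sends `z` to parameters at most `2z - z²` (minus) and `z²` (plus); see
`bhattacharyya_add_le` and `bhattacharyya_sup_add_le`. These two upper bounds suffice. The average
of `(1 - z)²` over the two children is at least `((1 - z)⁴ + (1 - z²)²) / 2 = (1 - z)² + (z(1 -
z))²`. Hence the level averages of `(1 - z)²` increase, are bounded by `1` and converge; their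
increments, which dominate the averages of `(z(1 - z))²`, tend to `0` (`tendsto_polarAverage`).
Cauchy–Schwarz passes to averages of `z(1 - z)`.

The link with `F^{⊗n}` is an induction that peels off the outer Kronecker factor
(`sum_bhattacharyya_output`). It relies on the parameter depending only on the joint law of bit and
side information. -/

namespace Polar

/-! ### Scalar inequalities -/

lemma mul_log_sq_le {p : ℝ} (h0 : 0 ≤ p) (h1 : p ≤ 1) :
    p * Real.log p ^ 2 ≤ 16 * √(p * (1 - p)) := by
  rcases h0.eq_or_lt with rfl | hp
  · simp
  -- With the fourth root `s`, the left side is `16 s² (s log s)²`, and `|s log s| ≤ 1 - s` absorbs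
  -- the logarithm while `s²` supplies `√p`.
  obtain ⟨s, hs, rfl⟩ : ∃ s : ℝ, 0 < s ∧ s ^ 4 = p :=
    ⟨p ^ (1 / 4 : ℝ), by positivity, by rw [← Real.rpow_natCast, ← Real.rpow_mul h0]; norm_num⟩
  have hs1 : s ≤ 1 := by
    by_contra! h
    have := one_lt_pow₀ h (n := 4) (by norm_num)
    linarith
  have hlog : -Real.log s ≤ (1 - s) / s := by
    have := Real.one_sub_inv_le_log_of_pos hs
    have h2 : (1 - s) / s = s⁻¹ - 1 := by field_simp
    linarith
  have hlog0 : 0 ≤ -Real.log s := by linarith [Real.log_nonpos hs.le hs1]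
  have hsl : s * (-Real.log s) ≤ 1 - s := by
    rw [le_div_iff₀ hs] at hlog; linarith
  have hsq : (s * (-Real.log s)) ^ 2 ≤ (1 - s) ^ 2 := by gcongr
  have hrt : s ^ 2 * (1 - s) ≤ √(s ^ 4 * (1 - s ^ 4)) := by
    apply Real.le_sqrt_of_sq_le
    have h4 : (1 - s) ^ 2 ≤ 1 - s ^ 4 := by nlinarith [pow_pos hs 2, pow_pos hs 3, mul_nonneg hs.le (sub_nonneg.2 hs1), mul_nonneg (pow_pos hs 3).le (sub_nonneg.2 hs1)]
    calc (s ^ 2 * (1 - s)) ^ 2 = s ^ 4 * (1 - s) ^ 2 := by ring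
      _ ≤ _ := by gcongr
  calc s ^ 4 * Real.log (s ^ 4) ^ 2 = 16 * s ^ 2 * (s * (-Real.log s)) ^ 2 := by
        rw [Real.log_pow]; push_cast; ring
    _ ≤ 16 * s ^ 2 * (1 - s) ^ 2 := by gcongr
    _ ≤ 16 * (s ^ 2 * (1 - s)) := by
        nlinarith [mul_nonneg (mul_nonneg (pow_pos hs 2).le (sub_nonneg.2 hs1)) hs.le]
    _ ≤ _ := by gcongr

/-- Measures the deviation from a fair bit, where `s = √(2p)` equals `1`. The left side is `2 (s log
s)²`; below `1` use `log s ≥ 1 - 1/s`, above `1` use `log s ≤ s - 1` and `s² ≤ 2`. -/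
lemma mul_log_two_mul_sq_le {p : ℝ} (h0 : 0 ≤ p) (h1 : p ≤ 1) :
    p * Real.log (2 * p) ^ 2 ≤ 4 * (√(2 * p) - 1) ^ 2 := by
  rcases h0.eq_or_lt with rfl | hp
  · simp
  set s := √(2 * p) with hs_def
  have hs : 0 < s := by positivity
  have hss : s ^ 2 = 2 * p := Real.sq_sqrt (by positivity)
  have hlog : (s * Real.log s) ^ 2 ≤ 2 * (s - 1) ^ 2 := by
    rcases le_total s 1 with h | h
    · have h1 := Real.one_sub_inv_le_log_of_pos hs
      have h2 := Real.log_nonpos hs.le h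
      have h3 : s * (1 - s⁻¹) ≤ s * Real.log s := by gcongr
      have h4 : s * (1 - s⁻¹) = s - 1 := by field_simp
      rw [h4] at h3
      nlinarith [mul_nonneg hs.le (neg_nonneg.2 h2)]
    · have h1 := Real.log_le_sub_one_of_pos hs
      have h2 := Real.log_nonneg h
      rw [mul_pow]
      have : s ^ 2 ≤ 2 := by linarith
      gcongr
  have hl : Real.log (2 * p) = 2 * Real.log s := by rw [← hss, Real.log_pow]; norm_num
  rw [hl]
  have : p = s ^ 2 / 2 := by linarith
  calc p * (2 * Real.log s) ^ 2 = 2 * (s * Real.log s) ^ 2 := by rw [this]; ring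
    _ ≤ _ := by linarith

lemma sq_sqrt_sub_one_add_le {p q : ℝ} (hp : 0 ≤ p) (hq : 0 ≤ q) (h : p + q = 1) :
    (√(2 * p) - 1) ^ 2 + (√(2 * q) - 1) ^ 2 ≤ 2 * (1 - 2 * √(p * q)) := by
  have ha : √(2 * p) ^ 2 = 2 * p := Real.sq_sqrt (by positivity)
  have hb : √(2 * q) ^ 2 = 2 * q := Real.sq_sqrt (by positivity)
  have hab : 2 * √(p * q) = √(2 * p) * √(2 * q) := by
    rw [← Real.sqrt_mul (by positivity), show 2 * p * (2 * q) = 2 ^ 2 * (p * q) by ring,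
      Real.sqrt_mul (by positivity : (0 : ℝ) ≤ 2 ^ 2), Real.sqrt_sq (by norm_num)]
  rw [hab]
  have h1 := Real.sqrt_nonneg (2 * p)
  have h2 := Real.sqrt_nonneg (2 * q)
  set a := √(2 * p)
  set b := √(2 * q)
  have hs : a ^ 2 + b ^ 2 = 2 := by linarith
  have hle : a + b ≤ 2 := by nlinarith [sq_nonneg (a - b)]
  -- Since `a² + b² = 2`, the sides are `4 - 2(a + b)` and `4 - (a + b)²`.
  nlinarith [mul_nonneg (add_nonneg h1 h2) (sub_nonneg.2 hle)]

lemma entropy_sq_le {p q : ℝ} (hp : 0 ≤ p) (hq : 0 ≤ q) (h : p + q = 1) :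
    p * (-Real.logb 2 p) ^ 2 + q * (-Real.logb 2 q) ^ 2 ≤
      32 / Real.log 2 ^ 2 * √(p * q) := by
  have hl : 0 < Real.log 2 := Real.log_pos (by norm_num)
  have h1 := mul_log_sq_le hp (by linarith)
  have h2 := mul_log_sq_le hq (by linarith)
  rw [show 1 - p = q by linarith] at h1
  rw [show 1 - q = p by linarith, mul_comm q p] at h2
  calc _ = (p * Real.log p ^ 2 + q * Real.log q ^ 2) / Real.log 2 ^ 2 := by
        simp only [Real.logb]; field_simp
    _ ≤ (32 * √(p * q)) / Real.log 2 ^ 2 := by gcongr; linarith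
    _ = _ := by ring

lemma mul_neg_logb_sub_one_sq (p : ℝ) :
    p * (-Real.logb 2 p - 1) ^ 2 = p * Real.log (2 * p) ^ 2 / Real.log 2 ^ 2 := by
  have hl : 0 < Real.log 2 := Real.log_pos (by norm_num)
  -- At `p = 0` the factor `p` kills both sides, whatever the value of `log 0`.
  rcases eq_or_ne p 0 with rfl | hp
  · simp
  rw [Real.log_mul (by norm_num) hp, Real.logb]
  field_simp
  ring

lemma entropy_sub_one_sq_le {p q : ℝ} (hp : 0 ≤ p) (hq : 0 ≤ q) (h : p + q = 1) :
    p * (-Real.logb 2 p - 1) ^ 2 + q * (-Real.logb 2 q - 1) ^ 2 ≤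
      8 / Real.log 2 ^ 2 * (1 - 2 * √(p * q)) := by
  have hl : 0 < Real.log 2 := Real.log_pos (by norm_num)
  rw [mul_neg_logb_sub_one_sq, mul_neg_logb_sub_one_sq, ← add_div]
  have h1 := mul_log_two_mul_sq_le hp (by linarith)
  have h2 := mul_log_two_mul_sq_le hq (by linarith)
  have h3 := sq_sqrt_sub_one_add_le hp hq h
  calc _ ≤ (8 * (1 - 2 * √(p * q))) / Real.log 2 ^ 2 := by gcongr; linarith
    _ = _ := by ring

/-- The Bhattacharyya parameter of the minus transform is at most that of two erasure channels. -/
lemma two_mul_sqrt_convolution_le {p q r s : ℝ} (hp : 0 ≤ p) (hq : 0 ≤ q) (hr : 0 ≤ r)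
    (hs : 0 ≤ s) (hpq : p + q = 1) (hrs : r + s = 1) :
    2 * √((p * r + q * s) * (p * s + q * r)) ≤
      2 * √(p * q) + 2 * √(r * s) - 2 * √(p * q) * (2 * √(r * s)) := by
  have key : ∀ {p q : ℝ}, 0 ≤ p → 0 ≤ q → p + q = 1 →
      0 ≤ 2 * √(p * q) ∧ 2 * √(p * q) ≤ 1 ∧ (2 * √(p * q)) ^ 2 = 4 * (p * q) := by
    intro p q hp hq h
    have : (2 * √(p * q)) ^ 2 = 4 * (p * q) := by
      rw [mul_pow, Real.sq_sqrt (by positivity)]; norm_num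
    refine ⟨by positivity, ?_, this⟩
    nlinarith [sq_nonneg (p - q), Real.sqrt_nonneg (p * q)]
  obtain ⟨a0, a1, a2⟩ := key hp hq hpq
  obtain ⟨b0, b1, b2⟩ := key hr hs hrs
  obtain ⟨-, -, c2⟩ := key (p := p * r + q * s) (q := p * s + q * r) (by positivity) (by positivity)
    (by linear_combination (r + s) * hpq + hrs)
  set a := 2 * √(p * q)
  set b := 2 * √(r * s)
  -- Biases multiply under addition of independent bits, and `1 - a² = (p - q)²`, so `1 - c² = (1 -
  -- a²)(1 - b²)`. The square of the target bound exceeds `c²` by `2ab(1 - a)(1 - b)`.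
  have hc : (2 * √((p * r + q * s) * (p * s + q * r))) ^ 2 = a ^ 2 + b ^ 2 - a ^ 2 * b ^ 2 := by
    rw [c2, a2, b2]
    obtain rfl : q = 1 - p := by linarith
    obtain rfl : s = 1 - r := by linarith
    ring
  refine abs_le_of_sq_le_sq' ?_ ?_ |>.2
  · rw [hc]
    nlinarith [mul_nonneg (mul_nonneg a0 b0) (mul_nonneg (sub_nonneg.2 a1) (sub_nonneg.2 b1))]
  · nlinarith [mul_nonneg a0 (sub_nonneg.2 b1)]

/-- Cauchy–Schwarz in two terms: after squaring, the gap is `a b (s v - u t)²`. Joint concavity is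
what conditional Jensen needs for the plus transform. -/
lemma concaveOn_sqrt_mul :
    ConcaveOn ℝ (Set.Ici 0 : Set (ℝ × ℝ)) (fun x => √(x.1 * x.2)) := by
  refine ⟨convex_Ici 0, ?_⟩
  rintro ⟨x1, x2⟩ hx ⟨y1, y2⟩ hy a b ha hb -
  obtain ⟨hx1, hx2⟩ : 0 ≤ x1 ∧ 0 ≤ x2 := by simpa [Prod.le_def] using hx
  obtain ⟨hy1, hy2⟩ : 0 ≤ y1 ∧ 0 ≤ y2 := by simpa [Prod.le_def] using hy
  simp only [smul_eq_mul, Prod.smul_mk, Prod.mk_add_mk]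
  apply Real.le_sqrt_of_sq_le
  rw [Real.sqrt_mul hx1, Real.sqrt_mul hy1]
  obtain ⟨s, hs, rfl⟩ : ∃ s : ℝ, 0 ≤ s ∧ s ^ 2 = x1 := ⟨√x1, by positivity, Real.sq_sqrt hx1⟩
  obtain ⟨t, ht, rfl⟩ : ∃ s : ℝ, 0 ≤ s ∧ s ^ 2 = x2 := ⟨√x2, by positivity, Real.sq_sqrt hx2⟩
  obtain ⟨u, hu, rfl⟩ : ∃ s : ℝ, 0 ≤ s ∧ s ^ 2 = y1 := ⟨√y1, by positivity, Real.sq_sqrt hy1⟩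
  obtain ⟨v, hv, rfl⟩ : ∃ s : ℝ, 0 ≤ s ∧ s ^ 2 = y2 := ⟨√y2, by positivity, Real.sq_sqrt hy2⟩
  rw [Real.sqrt_sq hs, Real.sqrt_sq ht, Real.sqrt_sq hu, Real.sqrt_sq hv]
  nlinarith [mul_nonneg (mul_nonneg ha hb) (sq_nonneg (s * v - u * t))]

/-! ### Conditional probabilities and Bhattacharyya parameter of a bit -/

section
variable {Ω : Type*} {m mΩ : MeasurableSpace Ω} {μ : Measure Ω} {X : Ω → ZMod 2}

/-- The conditional probability of `{X = x}` given the `σ`-algebra `m`. -/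
noncomputable def condProb (μ : Measure Ω) (m : MeasurableSpace Ω) (X : Ω → ZMod 2)
    (x : ZMod 2) : Ω → ℝ := μ⟦X ⁻¹' {x} | m⟧

/-- The Bhattacharyya parameter of `X` given the `σ`-algebra `m`. -/
noncomputable def bhattacharyya (μ : Measure Ω) (m : MeasurableSpace Ω) (X : Ω → ZMod 2) : ℝ :=
  ∫ ω, 2 * √(condProb μ m X 0 ω * condProb μ m X 1 ω) ∂μ

lemma stronglyMeasurable_condProb (x : ZMod 2) : StronglyMeasurable[m] (condProb μ m X x) :=
  stronglyMeasurable_condExp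

lemma measurable_bhattacharyya_integrand :
    Measurable[m] fun ω => 2 * √(condProb μ m X 0 ω * condProb μ m X 1 ω) :=
  (((stronglyMeasurable_condProb 0).measurable.mul
    (stronglyMeasurable_condProb 1).measurable).sqrt).const_mul 2

lemma bhattacharyya_nonneg : 0 ≤ bhattacharyya μ m X :=
  integral_nonneg fun _ => by positivity

lemma _root_.Measurable.neg_logb_sub_sq {f : Ω → ℝ} (hf : Measurable[mΩ] f) (b c : ℝ) :
    Measurable[mΩ] fun ω => (-Real.logb b (f ω) - c) ^ 2 :=
  (((Real.measurable_log.comp hf).div_const _).neg.sub_const c).pow_const 2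

variable [IsProbabilityMeasure μ]

lemma condExp_indicator_mem_Icc (hm : m ≤ mΩ) {A : Set Ω} (hA : MeasurableSet[mΩ] A) :
    ∀ᵐ ω ∂μ, 0 ≤ (μ⟦A | m⟧) ω ∧ (μ⟦A | m⟧) ω ≤ 1 := by
  have hi : Integrable (A.indicator fun _ => (1 : ℝ)) μ := (integrable_const 1).indicator hA
  have h0 := condExp_nonneg (μ := μ) (m := m) (f := A.indicator fun _ => (1 : ℝ))
    (ae_of_all _ fun ω => Set.indicator_nonneg (fun _ _ => zero_le_one) ω)
  have h1 := condExp_mono (m := m) hi (integrable_const (μ := μ) (1 : ℝ))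
    (ae_of_all _ fun ω => Set.indicator_le_self' (fun _ _ => zero_le_one) ω)
  rw [condExp_const hm] at h1
  filter_upwards [h0, h1] with ω h h' using ⟨h, h'⟩

/-- Integrating an `m`-measurable function over a set weights it by the conditional probability. -/
lemma setLIntegral_eq_lintegral_mul_condExp (hm : m ≤ mΩ) {A : Set Ω} (hA : MeasurableSet[mΩ] A)
    {f : Ω → ENNReal} (hf : Measurable[m] f) :
    ∫⁻ ω in A, f ω ∂μ = ∫⁻ ω, ENNReal.ofReal ((μ⟦A | m⟧) ω) * f ω ∂μ := by
  have hi : Integrable (A.indicator fun _ => (1 : ℝ)) μ := (integrable_const 1).indicator hA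
  have hg : Measurable[m] fun ω => ENNReal.ofReal ((μ⟦A | m⟧) ω) :=
    stronglyMeasurable_condExp.measurable.ennreal_ofReal
  have h0 : ∀ᵐ ω ∂μ, 0 ≤ (μ⟦A | m⟧) ω := (condExp_indicator_mem_Icc hm hA).mono fun _ h => h.1
  -- On `m`, the restriction of `μ` to `A` has density the conditional probability of `A`.
  have key : (μ.restrict A).trim hm =
      (μ.trim hm).withDensity fun ω => ENNReal.ofReal ((μ⟦A | m⟧) ω) := by
    refine @Measure.ext _ m _ _ fun s hs => ?_
    rw [trim_measurableSet_eq hm hs, Measure.restrict_apply (hm s hs), withDensity_apply _ hs,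
      restrict_trim hm _ hs, lintegral_trim hm hg,
      ← ofReal_integral_eq_lintegral_ofReal integrable_condExp.integrableOn
        (ae_restrict_of_ae h0), setIntegral_condExp hm hi hs, setIntegral_indicator hA]
    simp
  rw [← lintegral_trim hm hf, key, lintegral_withDensity_eq_lintegral_mul _ hg hf,
    lintegral_trim hm (hg.mul hf)]
  rfl

lemma condProb_nonneg (hm : m ≤ mΩ) (hX : Measurable X) :
    ∀ᵐ ω ∂μ, ∀ x, 0 ≤ condProb μ m X x ω :=
  ae_all_iff.2 fun x => (condExp_indicator_mem_Icc hm (hX (measurableSet_singleton x))).mono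
    fun _ h => h.1

lemma condProb_add_eq_one (hm : m ≤ mΩ) (hX : Measurable X) :
    ∀ᵐ ω ∂μ, condProb μ m X 0 ω + condProb μ m X 1 ω = 1 := by
  have hi : ∀ x, Integrable ((X ⁻¹' {x}).indicator fun _ => (1 : ℝ)) μ := fun x =>
    (integrable_const 1).indicator (hX (measurableSet_singleton x))
  have h := condExp_add (hi 0) (hi 1) m
  have h1 : ((X ⁻¹' {0}).indicator fun _ => (1 : ℝ)) + ((X ⁻¹' {1}).indicator fun _ => (1 : ℝ)) =
      fun _ => 1 := by
    ext ω
    have : X ω = 0 ∨ X ω = 1 := by generalize X ω = x; revert x; decide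
    rcases this with h | h <;> simp [h]
  rw [h1, condExp_const hm] at h
  filter_upwards [h] with ω h using h.symm

lemma two_mul_sqrt_mul_le_one {p q : ℝ} (h : p + q = 1) : 2 * √(p * q) ≤ 1 := by
  have : √(p * q) ≤ √((1 / 2) ^ 2) := by
    apply Real.sqrt_le_sqrt
    nlinarith [sq_nonneg (p - q)]
  rw [Real.sqrt_sq (by norm_num)] at this
  linarith

lemma integrable_bhattacharyya_integrand (hm : m ≤ mΩ) (hX : Measurable X) :
    Integrable (fun ω => 2 * √(condProb μ m X 0 ω * condProb μ m X 1 ω)) μ := by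
  refine Integrable.of_bound (measurable_bhattacharyya_integrand.mono hm le_rfl).aestronglyMeasurable
    1 ?_
  filter_upwards [condProb_add_eq_one hm hX] with ω h
  rw [Real.norm_of_nonneg (by positivity)]
  exact two_mul_sqrt_mul_le_one h

lemma bhattacharyya_le_one (hm : m ≤ mΩ) (hX : Measurable X) : bhattacharyya μ m X ≤ 1 := by
  have := integral_mono_ae (integrable_bhattacharyya_integrand hm hX) (integrable_const (μ := μ) 1)
    ((condProb_add_eq_one hm hX).mono fun ω h => two_mul_sqrt_mul_le_one h)
  simpa [bhattacharyya] using this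

/-- Split according to the value of `X`; on each piece the integrand is `m`-measurable and picks up
the conditional probability as weight. Working in `ENNReal` avoids presupposing integrability, which
is deduced from this identity. -/
lemma lintegral_neg_logb_condProb_sub_sq (hm : m ≤ mΩ) (hX : Measurable X) (c : ℝ) :
    ∫⁻ ω, ENNReal.ofReal ((-Real.logb 2 (condProb μ m X (X ω) ω) - c) ^ 2) ∂μ =
      ∫⁻ ω, ENNReal.ofReal
        (condProb μ m X 0 ω *
            (-Real.logb 2 (condProb μ m X 0 ω) - c) ^ 2 +
          condProb μ m X 1 ω *
            (-Real.logb 2 (condProb μ m X 1 ω) - c) ^ 2) ∂μ := by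
  have hF (x : ZMod 2) : Measurable[m] fun ω =>
      ENNReal.ofReal ((-Real.logb 2 (condProb μ m X x ω) - c) ^ 2) :=
    ((stronglyMeasurable_condProb x).measurable.neg_logb_sub_sq 2 c).ennreal_ofReal
  have hset (x : ZMod 2) : ∫⁻ ω in X ⁻¹' {x}, ENNReal.ofReal ((-Real.logb 2 (condProb μ m X (X ω) ω) - c) ^ 2) ∂μ =
      ∫⁻ ω, ENNReal.ofReal (condProb μ m X x ω *
        (-Real.logb 2 (condProb μ m X x ω) - c) ^ 2) ∂μ := by
    have h1 : ∫⁻ ω in X ⁻¹' {x}, ENNReal.ofReal ((-Real.logb 2 (condProb μ m X (X ω) ω) - c) ^ 2) ∂μ =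
        ∫⁻ ω in X ⁻¹' {x}, ENNReal.ofReal ((-Real.logb 2 (condProb μ m X x ω) - c) ^ 2) ∂μ := by
      refine setLIntegral_congr_fun (hX (measurableSet_singleton x)) fun ω hω => ?_
      have : X ω = x := hω
      simp only [this]
    rw [h1, setLIntegral_eq_lintegral_mul_condExp hm (hX (measurableSet_singleton x)) (hF x)]
    refine lintegral_congr_ae ?_
    filter_upwards [condProb_nonneg hm hX] with ω h
    rw [ENNReal.ofReal_mul (h x)]
    rfl
  have hcompl : (X ⁻¹' {0})ᶜ = X ⁻¹' {1} := by
    ext ω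
    have : ∀ x : ZMod 2, x ≠ 0 ↔ x = 1 := by decide
    exact this (X ω)
  rw [← lintegral_add_compl _ (hX (measurableSet_singleton 0)), hcompl, hset, hset,
    ← lintegral_add_left']
  · refine lintegral_congr_ae ?_
    filter_upwards [condProb_nonneg hm hX] with ω h
    rw [ENNReal.ofReal_add (mul_nonneg (h 0) (sq_nonneg _)) (mul_nonneg (h 1) (sq_nonneg _))]
  · refine Measurable.aemeasurable ?_
    have hc := (stronglyMeasurable_condProb (μ := μ) (m := m) (X := X) 0).measurable.mono hm le_rfl
    exact (hc.mul (hc.neg_logb_sub_sq 2 c)).ennreal_ofReal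

end

/-! ### Varentropy controlled by the Bhattacharyya parameter -/

section
variable {Ω 𝓨 : Type*} [mΩ : MeasurableSpace Ω] [MeasurableSpace 𝓨] {μ : Measure Ω}
  {X : Ω → ZMod 2} {Y : Ω → 𝓨}

lemma measurable_entropyRV (hX : Measurable X) (hY : Measurable Y) :
    Measurable (entropyRV μ X Y) := by
  have h : Measurable fun z : ZMod 2 × Ω =>
      -Real.logb 2 (condProb μ (.comap Y inferInstance) X z.1 z.2) := by
    refine measurable_from_prod_countable_right fun x => ?_
    exact ((Real.measurable_log.comp ((stronglyMeasurable_condProb x).measurable.mono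
      hY.comap_le le_rfl)).div_const _).neg
  exact h.comp (hX.prodMk measurable_id)

lemma varentropy_nonneg : 0 ≤ varentropy μ X Y := variance_nonneg _ _

variable [IsProbabilityMeasure μ]

lemma entropyRV_sub_sq_bound (hX : Measurable X) (hY : Measurable Y) {c : ℝ} {g : Ω → ℝ}
    (hg : Integrable g μ)
    (hle : ∀ᵐ ω ∂μ, condProb μ (.comap Y inferInstance) X 0 ω *
            (-Real.logb 2 (condProb μ (.comap Y inferInstance) X 0 ω) - c) ^ 2 +
          condProb μ (.comap Y inferInstance) X 1 ω *
            (-Real.logb 2 (condProb μ (.comap Y inferInstance) X 1 ω) - c) ^ 2 ≤ g ω) :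
    Integrable (fun ω => (entropyRV μ X Y ω - c) ^ 2) μ ∧
      ∫ ω, (entropyRV μ X Y ω - c) ^ 2 ∂μ ≤ ∫ ω, g ω ∂μ := by
  have hmeas : Measurable fun ω => (entropyRV μ X Y ω - c) ^ 2 :=
    ((measurable_entropyRV hX hY).sub_const c).pow_const 2
  have hg0 : 0 ≤ᵐ[μ] g := by
    filter_upwards [hle, condProb_nonneg hY.comap_le hX] with ω h h'
    exact le_trans (add_nonneg (mul_nonneg (h' 0) (sq_nonneg _)) (mul_nonneg (h' 1) (sq_nonneg _))) h
  have hb : ∫⁻ ω, ENNReal.ofReal ((entropyRV μ X Y ω - c) ^ 2) ∂μ ≤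
      ENNReal.ofReal (∫ ω, g ω ∂μ) := by
    rw [ofReal_integral_eq_lintegral_ofReal hg hg0]
    refine (lintegral_neg_logb_condProb_sub_sq hY.comap_le hX c).trans_le ?_
    exact lintegral_mono_ae (hle.mono fun ω h => ENNReal.ofReal_le_ofReal h)
  constructor
  · refine ⟨hmeas.aestronglyMeasurable, ?_⟩
    rw [hasFiniteIntegral_iff_ofReal (ae_of_all _ fun _ => sq_nonneg _)]
    exact hb.trans_lt ENNReal.ofReal_lt_top
  · rw [integral_eq_lintegral_of_nonneg_ae (ae_of_all _ fun _ => sq_nonneg _)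
      hmeas.aestronglyMeasurable]
    exact ENNReal.toReal_le_of_le_ofReal (integral_nonneg_of_ae hg0) hb

lemma entropyRV_sq_bound (hX : Measurable X) (hY : Measurable Y) :
    Integrable (fun ω => (entropyRV μ X Y ω - 0) ^ 2) μ ∧
      ∫ ω, (entropyRV μ X Y ω - 0) ^ 2 ∂μ ≤
        16 / Real.log 2 ^ 2 * bhattacharyya μ (.comap Y inferInstance) X := by
  rw [bhattacharyya, ← integral_const_mul]
  refine entropyRV_sub_sq_bound hX hY
    ((integrable_bhattacharyya_integrand hY.comap_le hX).const_mul _) ?_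
  filter_upwards [condProb_nonneg hY.comap_le hX, condProb_add_eq_one hY.comap_le hX] with ω h h'
  have := entropy_sq_le (h 0) (h 1) h'
  simp only [sub_zero]
  exact this.trans_eq (by ring)

lemma entropyRV_sub_one_sq_bound (hX : Measurable X) (hY : Measurable Y) :
    Integrable (fun ω => (entropyRV μ X Y ω - 1) ^ 2) μ ∧
      ∫ ω, (entropyRV μ X Y ω - 1) ^ 2 ∂μ ≤
        8 / Real.log 2 ^ 2 * (1 - bhattacharyya μ (.comap Y inferInstance) X) := by
  have hi := integrable_bhattacharyya_integrand (μ := μ) hY.comap_le hX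
  have : 1 - bhattacharyya μ (.comap Y inferInstance) X = ∫ ω, (1 -
      2 * √(condProb μ (.comap Y inferInstance) X 0 ω *
        condProb μ (.comap Y inferInstance) X 1 ω)) ∂μ := by
    rw [integral_sub (integrable_const 1) hi]
    simp [bhattacharyya]
  rw [this, ← integral_const_mul]
  refine entropyRV_sub_sq_bound hX hY (((integrable_const 1).sub hi).const_mul _) ?_
  filter_upwards [condProb_nonneg hY.comap_le hX, condProb_add_eq_one hY.comap_le hX] with ω h h'
  exact entropy_sub_one_sq_le (h 0) (h 1) h'

lemma memLp_entropyRV (hX : Measurable X) (hY : Measurable Y) : MemLp (entropyRV μ X Y) 2 μ := by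
  rw [memLp_two_iff_integrable_sq (measurable_entropyRV hX hY).aestronglyMeasurable]
  simpa using (entropyRV_sq_bound (μ := μ) hX hY).1

lemma varentropy_le_integral_sub_sq (hX : Measurable X) (hY : Measurable Y) (c : ℝ) :
    varentropy μ X Y ≤ ∫ ω, (entropyRV μ X Y ω - c) ^ 2 ∂μ := by
  have hm := (measurable_entropyRV (μ := μ) hX hY).aestronglyMeasurable (μ := μ)
  rw [varentropy, ← variance_sub_const hm c]
  exact variance_le_expectation_sq (hm.sub aestronglyMeasurable_const)

/-- The variance is at most the second moment about any constant. Centre `0` gives `2kz` and centre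
`1` gives `k(1 - z)` with `k = 8 / log² 2`; one of them is below `4kz(1 - z)` according to the side
of `1/2` on which `z` lies. -/
lemma varentropy_le (hX : Measurable X) (hY : Measurable Y) :
    varentropy μ X Y ≤ 32 / Real.log 2 ^ 2 *
      (bhattacharyya μ (.comap Y inferInstance) X *
        (1 - bhattacharyya μ (.comap Y inferInstance) X)) := by
  have h0 := (varentropy_le_integral_sub_sq hX hY 0).trans (entropyRV_sq_bound (μ := μ) hX hY).2
  have h1 := (varentropy_le_integral_sub_sq hX hY 1).trans
    (entropyRV_sub_one_sq_bound (μ := μ) hX hY).2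
  have hz0 : 0 ≤ bhattacharyya μ (.comap Y inferInstance) X := bhattacharyya_nonneg
  have hz1 : bhattacharyya μ (.comap Y inferInstance) X ≤ 1 := bhattacharyya_le_one hY.comap_le hX
  set z := bhattacharyya μ (.comap Y inferInstance) X
  have hl : 0 < 8 / Real.log 2 ^ 2 := by
    have : 0 < Real.log 2 := Real.log_pos (by norm_num)
    positivity
  rw [show 16 / Real.log 2 ^ 2 = 2 * (8 / Real.log 2 ^ 2) by ring] at h0
  rw [show 32 / Real.log 2 ^ 2 = 4 * (8 / Real.log 2 ^ 2) by ring]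
  set k := 8 / Real.log 2 ^ 2
  rcases le_total z (1 / 2) with h | h
  · nlinarith [mul_nonneg (mul_nonneg hl.le hz0) (sub_nonneg.2 h)]
  · nlinarith [mul_nonneg (mul_nonneg hl.le (sub_nonneg.2 hz1)) (sub_nonneg.2 h)]

end

/-! ### Independent σ-algebras and conditional Jensen -/

lemma generateFrom_image2_inter {Ω : Type*} (m₁ m₂ : MeasurableSpace Ω) :
    m₁ ⊔ m₂ = MeasurableSpace.generateFrom
      (Set.image2 (· ∩ ·) {s | MeasurableSet[m₁] s} {s | MeasurableSet[m₂] s}) := by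
  apply le_antisymm
  · refine sup_le (fun s hs => ?_) (fun s hs => ?_)
    · exact MeasurableSpace.measurableSet_generateFrom
        ⟨s, hs, Set.univ, @MeasurableSet.univ _ m₂, Set.inter_univ s⟩
    · exact MeasurableSpace.measurableSet_generateFrom
        ⟨Set.univ, @MeasurableSet.univ _ m₁, s, hs, Set.univ_inter s⟩
  · refine MeasurableSpace.generateFrom_le ?_
    rintro _ ⟨s, hs, t, ht, rfl⟩
    exact @MeasurableSet.inter _ (m₁ ⊔ m₂) _ _ (le_sup_left (a := m₁) s hs)
      (le_sup_right (b := m₂) t ht)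

lemma isPiSystem_image2_inter {Ω : Type*} (m₁ m₂ : MeasurableSpace Ω) :
    IsPiSystem (Set.image2 (· ∩ ·) {s | MeasurableSet[m₁] s} {s | MeasurableSet[m₂] s}) := by
  rintro _ ⟨s, hs, t, ht, rfl⟩ _ ⟨s', hs', t', ht', rfl⟩ -
  exact ⟨s ∩ s', @MeasurableSet.inter _ m₁ _ _ hs hs', t ∩ t', @MeasurableSet.inter _ m₂ _ _ ht ht',
    Set.inter_inter_inter_comm s s' t t'⟩

section
variable {Ω : Type*} {m m₁ m₂ n₁ n₂ mΩ : MeasurableSpace Ω} {μ : Measure Ω}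

lemma integral_mul_of_indep (h : Indep n₁ n₂ μ) (hn₁ : n₁ ≤ mΩ) (hn₂ : n₂ ≤ mΩ) {f g : Ω → ℝ}
    (hf : Measurable[n₁] f) (hg : Measurable[n₂] g) :
    ∫ ω, f ω * g ω ∂μ = (∫ ω, f ω ∂μ) * ∫ ω, g ω ∂μ := by
  have hi : IndepFun f g μ := (IndepFun_iff_Indep _ _ _).2
    (indep_of_indep_of_le_left (indep_of_indep_of_le_right h hg.comap_le) hf.comap_le)
  exact hi.integral_mul_eq_mul_integral (hf.mono hn₁ le_rfl).aestronglyMeasurable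
    (hg.mono hn₂ le_rfl).aestronglyMeasurable

variable [IsProbabilityMeasure μ]

lemma integrable_of_mem_Icc {f : Ω → ℝ} (hf : AEStronglyMeasurable f μ)
    (h : ∀ᵐ ω ∂μ, 0 ≤ f ω ∧ f ω ≤ 1) : Integrable f μ :=
  Integrable.of_bound hf 1 (h.mono fun ω h => by rw [Real.norm_of_nonneg h.1]; exact h.2)

/-- Conditional probabilities multiply across independent `σ`-algebras. -/
lemma condExp_inter_of_indep (h : Indep n₁ n₂ μ) (hn₁ : n₁ ≤ mΩ) (hn₂ : n₂ ≤ mΩ)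
    (hm₁ : m₁ ≤ n₁) (hm₂ : m₂ ≤ n₂) {A₁ A₂ : Set Ω} (hA₁ : MeasurableSet[n₁] A₁)
    (hA₂ : MeasurableSet[n₂] A₂) :
    μ⟦A₁ ∩ A₂ | m₁ ⊔ m₂⟧ =ᵐ[μ] fun ω => (μ⟦A₁ | m₁⟧) ω * (μ⟦A₂ | m₂⟧) ω := by
  have hm : m₁ ⊔ m₂ ≤ mΩ := sup_le (hm₁.trans hn₁) (hm₂.trans hn₂)
  have hA : MeasurableSet (A₁ ∩ A₂) := (hn₁ _ hA₁).inter (hn₂ _ hA₂)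
  have hf : Integrable ((A₁ ∩ A₂).indicator fun _ => (1 : ℝ)) μ := (integrable_const 1).indicator hA
  have hs₁ : StronglyMeasurable[m₁] (μ⟦A₁ | m₁⟧) := stronglyMeasurable_condExp
  have hs₂ : StronglyMeasurable[m₂] (μ⟦A₂ | m₂⟧) := stronglyMeasurable_condExp
  have hsm : StronglyMeasurable[m₁ ⊔ m₂] fun ω => (μ⟦A₁ | m₁⟧) ω * (μ⟦A₂ | m₂⟧) ω :=
    (hs₁.mono le_sup_left).mul (hs₂.mono le_sup_right)
  have hg : Integrable (fun ω => (μ⟦A₁ | m₁⟧) ω * (μ⟦A₂ | m₂⟧) ω) μ := by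
    refine integrable_of_mem_Icc (hsm.mono hm).aestronglyMeasurable ?_
    filter_upwards [condExp_indicator_mem_Icc (hm₁.trans hn₁) (hn₁ _ hA₁),
      condExp_indicator_mem_Icc (hm₂.trans hn₂) (hn₂ _ hA₂)] with ω h₁ h₂
    exact ⟨mul_nonneg h₁.1 h₂.1, mul_le_one₀ h₁.2 h₂.1 h₂.2⟩
  -- On rectangles both integrals factor by independence; a π-λ argument then reaches all of `m₁ ⊔
  -- m₂`.
  have hrect : ∀ s, MeasurableSet[m₁] s → ∀ t, MeasurableSet[m₂] t →
      ∫ ω in s ∩ t, (μ⟦A₁ | m₁⟧) ω * (μ⟦A₂ | m₂⟧) ω ∂μ =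
        ∫ ω in s ∩ t, (A₁ ∩ A₂).indicator (fun _ => (1 : ℝ)) ω ∂μ := by
    intro s hs t ht
    have e₁ := setIntegral_condExp (hm₁.trans hn₁)
      ((integrable_const (1 : ℝ)).indicator (hn₁ _ hA₁) : Integrable _ μ) hs
    have e₂ := setIntegral_condExp (hm₂.trans hn₂)
      ((integrable_const (1 : ℝ)).indicator (hn₂ _ hA₂) : Integrable _ μ) ht
    have hs' := hn₁ _ (hm₁ _ hs)
    have ht' := hn₂ _ (hm₂ _ ht)
    rw [← integral_indicator (hs'.inter ht')]
    have : (s ∩ t).indicator (fun ω => (μ⟦A₁ | m₁⟧) ω * (μ⟦A₂ | m₂⟧) ω) =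
        fun ω => s.indicator (μ⟦A₁ | m₁⟧) ω * t.indicator (μ⟦A₂ | m₂⟧) ω := by
      ext ω
      by_cases h₁ : ω ∈ s <;> by_cases h₂ : ω ∈ t <;> simp [h₁, h₂]
    rw [this, integral_mul_of_indep h hn₁ hn₂
      ((hs₁.measurable.indicator hs).mono hm₁ le_rfl)
      ((hs₂.measurable.indicator ht).mono hm₂ le_rfl), integral_indicator hs',
      integral_indicator ht', e₁, e₂, setIntegral_indicator (hn₁ _ hA₁),
      setIntegral_indicator (hn₂ _ hA₂), setIntegral_indicator hA, setIntegral_one_eq_measureReal,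
      setIntegral_one_eq_measureReal, setIntegral_one_eq_measureReal,
      Set.inter_inter_inter_comm]
    simp only [Measure.real]
    rw [(Indep_iff _ _ _).1 h _ _ (@MeasurableSet.inter _ n₁ _ _ (hm₁ _ hs) hA₁)
      (@MeasurableSet.inter _ n₂ _ _ (hm₂ _ ht) hA₂), ENNReal.toReal_mul]
  refine (ae_eq_condExp_of_forall_setIntegral_eq hm hf (fun _ _ _ => hg.integrableOn) ?_
    hsm.aestronglyMeasurable).symm
  intro s hs _
  refine MeasurableSpace.induction_on_inter (m := m₁ ⊔ m₂)
    (C := fun s _ => ∫ ω in s, (μ⟦A₁ | m₁⟧) ω * (μ⟦A₂ | m₂⟧) ω ∂μ =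
        ∫ ω in s, (A₁ ∩ A₂).indicator (fun _ => (1 : ℝ)) ω ∂μ)
    (generateFrom_image2_inter m₁ m₂) (isPiSystem_image2_inter m₁ m₂) (by simp) ?_ ?_ ?_ s hs
  · rintro _ ⟨s, hs, t, ht, rfl⟩
    exact hrect s hs t ht
  · intro t ht h
    have hu := hrect Set.univ (@MeasurableSet.univ _ m₁) Set.univ (@MeasurableSet.univ _ m₂)
    simp only [Set.univ_inter, setIntegral_univ] at hu
    have h1 := integral_add_compl (hm _ ht) hg
    have h2 := integral_add_compl (hm _ ht) hf
    linarith
  · intro f hd hfm h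
    rw [integral_iUnion (fun i => hm _ (hfm i)) hd hg.integrableOn,
      integral_iUnion (fun i => hm _ (hfm i)) hd hf.integrableOn]
    simp only [h]

lemma integrable_sqrt_mul {f g : Ω → ℝ} (hf : AEStronglyMeasurable f μ)
    (hg : AEStronglyMeasurable g μ) (hf1 : ∀ᵐ ω ∂μ, 0 ≤ f ω ∧ f ω ≤ 1)
    (hg1 : ∀ᵐ ω ∂μ, 0 ≤ g ω ∧ g ω ≤ 1) : Integrable (fun ω => √(f ω * g ω)) μ := by
  refine integrable_of_mem_Icc (Real.continuous_sqrt.comp_aestronglyMeasurable (hf.mul hg)) ?_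
  filter_upwards [hf1, hg1] with ω h h'
  exact ⟨Real.sqrt_nonneg _, Real.sqrt_le_one.2 (mul_le_one₀ h.2 h'.1 h'.2)⟩

/-- Coarsening the conditioning increases the integral of a geometric mean. -/
lemma integral_sqrt_mul_le (hm : m ≤ mΩ) {f g : Ω → ℝ} (hf : Integrable f μ)
    (hg : Integrable g μ) (hf1 : ∀ᵐ ω ∂μ, 0 ≤ f ω ∧ f ω ≤ 1)
    (hg1 : ∀ᵐ ω ∂μ, 0 ≤ g ω ∧ g ω ≤ 1) :
    ∫ ω, √(f ω * g ω) ∂μ ≤ ∫ ω, √((μ[f | m]) ω * (μ[g | m]) ω) ∂μ := by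
  have hfg := integrable_sqrt_mul hf.aestronglyMeasurable hg.aestronglyMeasurable hf1 hg1
  have hpair : Integrable (fun ω => (f ω, g ω)) μ := hf.prodMk hg
  have key := concaveOn_sqrt_mul.condExp_map_le hm (f := fun ω => (f ω, g ω)) (μ := μ)
    ((by fun_prop : Continuous fun x : ℝ × ℝ =>
      √(x.1 * x.2)).upperSemicontinuous.upperSemicontinuousOn _)
    (by filter_upwards [hf1, hg1] with ω h h'; exact ⟨h.1, h'.1⟩) isClosed_Ici hpair hfg
  -- Jensen concerns the conditional expectation of the pair; the projections identify its
  -- coordinates.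
  have hfst := (ContinuousLinearMap.fst ℝ ℝ ℝ).comp_condExp_comm hpair (m := m)
  have hsnd := (ContinuousLinearMap.snd ℝ ℝ ℝ).comp_condExp_comm hpair (m := m)
  have hbd : ∀ {f : Ω → ℝ}, Integrable f μ → (∀ᵐ ω ∂μ, 0 ≤ f ω ∧ f ω ≤ 1) →
      ∀ᵐ ω ∂μ, 0 ≤ (μ[f | m]) ω ∧ (μ[f | m]) ω ≤ 1 := by
    intro f hf h
    have h0 := condExp_nonneg (m := m) (h.mono fun _ h => h.1)
    have h1 := condExp_mono (m := m) hf (integrable_const (μ := μ) (1 : ℝ)) (h.mono fun _ h => h.2)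
    rw [condExp_const hm] at h1
    filter_upwards [h0, h1] with ω h h' using ⟨h, h'⟩
  rw [← integral_condExp hm]
  refine integral_mono_ae integrable_condExp
    (integrable_sqrt_mul integrable_condExp.aestronglyMeasurable
      integrable_condExp.aestronglyMeasurable (hbd hf hf1) (hbd hg hg1)) ?_
  filter_upwards [key, hfst, hsnd] with ω h h1 h2
  refine h.trans_eq ?_
  simp only [Function.comp_apply, ContinuousLinearMap.coe_fst', ContinuousLinearMap.coe_snd'] at h1 h2 ⊢
  rw [h1, h2]
  rfl

end

lemma eq_zero_or_eq_one (x : ZMod 2) : x = 0 ∨ x = 1 := by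
  revert x
  decide

/-! ### One step of the polar transform -/

section
variable {Ω : Type*} {m₁ m₂ mΩ : MeasurableSpace Ω} {μ : Measure Ω} {X₁ X₂ : Ω → ZMod 2}

lemma integral_bhattacharyya_mul (hm₁ : m₁ ≤ mΩ) (hm₂ : m₂ ≤ mΩ) (hX₁ : Measurable X₁)
    (hX₂ : Measurable X₂)
    (h : Indep (m₁ ⊔ .comap X₁ inferInstance) (m₂ ⊔ .comap X₂ inferInstance) μ) :
    ∫ ω, (2 * √(condProb μ m₁ X₁ 0 ω * condProb μ m₁ X₁ 1 ω)) *
      (2 * √(condProb μ m₂ X₂ 0 ω * condProb μ m₂ X₂ 1 ω)) ∂μ =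
        bhattacharyya μ m₁ X₁ * bhattacharyya μ m₂ X₂ :=
  integral_mul_of_indep h (sup_le hm₁ hX₁.comap_le) (sup_le hm₂ hX₂.comap_le)
    (measurable_bhattacharyya_integrand.mono le_sup_left le_rfl)
    (measurable_bhattacharyya_integrand.mono le_sup_left le_rfl)

variable [IsProbabilityMeasure μ]

lemma condExp_inter_preimage (hm₁ : m₁ ≤ mΩ) (hm₂ : m₂ ≤ mΩ) (hX₁ : Measurable X₁)
    (hX₂ : Measurable X₂)
    (h : Indep (m₁ ⊔ .comap X₁ inferInstance) (m₂ ⊔ .comap X₂ inferInstance) μ) (a b : ZMod 2) :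
    μ⟦X₁ ⁻¹' {a} ∩ X₂ ⁻¹' {b} | m₁ ⊔ m₂⟧ =ᵐ[μ]
      fun ω => condProb μ m₁ X₁ a ω * condProb μ m₂ X₂ b ω :=
  condExp_inter_of_indep h (sup_le hm₁ hX₁.comap_le) (sup_le hm₂ hX₂.comap_le) le_sup_left
    le_sup_left (le_sup_right (a := m₁) _ ⟨{a}, measurableSet_singleton a, rfl⟩)
    (le_sup_right (a := m₂) _ ⟨{b}, measurableSet_singleton b, rfl⟩)

lemma condProb_add (hm₁ : m₁ ≤ mΩ) (hm₂ : m₂ ≤ mΩ) (hX₁ : Measurable X₁) (hX₂ : Measurable X₂)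
    (h : Indep (m₁ ⊔ .comap X₁ inferInstance) (m₂ ⊔ .comap X₂ inferInstance) μ) (u : ZMod 2) :
    condProb μ (m₁ ⊔ m₂) (X₁ + X₂) u =ᵐ[μ] fun ω =>
      condProb μ m₁ X₁ 0 ω * condProb μ m₂ X₂ u ω +
        condProb μ m₁ X₁ 1 ω * condProb μ m₂ X₂ (u + 1) ω := by
  have hi : ∀ a b, Integrable ((X₁ ⁻¹' {a} ∩ X₂ ⁻¹' {b}).indicator fun _ => (1 : ℝ)) μ :=
    fun a b => (integrable_const 1).indicator
      ((hX₁ (measurableSet_singleton a)).inter (hX₂ (measurableSet_singleton b)))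
  have hs : ((X₁ + X₂) ⁻¹' {u}).indicator (fun _ => (1 : ℝ)) =
      (X₁ ⁻¹' {0} ∩ X₂ ⁻¹' {u}).indicator (fun _ => (1 : ℝ)) +
        (X₁ ⁻¹' {1} ∩ X₂ ⁻¹' {u + 1}).indicator (fun _ => (1 : ℝ)) := by
    ext ω
    simp only [Set.indicator, Set.mem_preimage, Pi.add_apply, Set.mem_singleton_iff,
      Set.mem_inter_iff]
    generalize X₁ ω = x
    generalize X₂ ω = y
    rcases eq_zero_or_eq_one x with rfl | rfl
    · simp
    · have : 1 + y = u ↔ y = u + 1 := by revert y u; decide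
      simp [this]
  have hadd := condExp_add (hi 0 u) (hi 1 (u + 1)) (m₁ ⊔ m₂)
  rw [condProb, hs]
  filter_upwards [hadd, condExp_inter_preimage hm₁ hm₂ hX₁ hX₂ h 0 u,
    condExp_inter_preimage hm₁ hm₂ hX₁ hX₂ h 1 (u + 1)] with ω h₁ h₂ h₃
  rw [h₁, Pi.add_apply, h₂, h₃]

lemma integrable_bhattacharyya_mul (hm₁ : m₁ ≤ mΩ) (hm₂ : m₂ ≤ mΩ) (hX₁ : Measurable X₁)
    (hX₂ : Measurable X₂) :
    Integrable (fun ω => (2 * √(condProb μ m₁ X₁ 0 ω * condProb μ m₁ X₁ 1 ω)) *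
      (2 * √(condProb μ m₂ X₂ 0 ω * condProb μ m₂ X₂ 1 ω))) μ := by
  refine integrable_of_mem_Icc
    ((measurable_bhattacharyya_integrand.mono hm₁ le_rfl).mul
      (measurable_bhattacharyya_integrand.mono hm₂ le_rfl)).aestronglyMeasurable ?_
  filter_upwards [condProb_add_eq_one hm₁ hX₁, condProb_add_eq_one hm₂ hX₂] with ω h₁ h₂
  exact ⟨by positivity, mul_le_one₀ (two_mul_sqrt_mul_le_one h₁) (by positivity)
    (two_mul_sqrt_mul_le_one h₂)⟩

/-- The minus transform. -/
lemma bhattacharyya_add_le (hm₁ : m₁ ≤ mΩ) (hm₂ : m₂ ≤ mΩ) (hX₁ : Measurable X₁)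
    (hX₂ : Measurable X₂)
    (h : Indep (m₁ ⊔ .comap X₁ inferInstance) (m₂ ⊔ .comap X₂ inferInstance) μ) :
    bhattacharyya μ (m₁ ⊔ m₂) (X₁ + X₂) ≤ bhattacharyya μ m₁ X₁ + bhattacharyya μ m₂ X₂ -
      bhattacharyya μ m₁ X₁ * bhattacharyya μ m₂ X₂ := by
  have i₁ := integrable_bhattacharyya_integrand (μ := μ) hm₁ hX₁
  have i₂ := integrable_bhattacharyya_integrand (μ := μ) hm₂ hX₂
  have i₃ := integrable_bhattacharyya_mul (μ := μ) hm₁ hm₂ hX₁ hX₂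
  -- Independence turns the product of parameters into one integral, so a pointwise comparison
  -- suffices.
  rw [← integral_bhattacharyya_mul hm₁ hm₂ hX₁ hX₂ h, bhattacharyya, bhattacharyya, bhattacharyya,
    ← integral_add i₁ i₂]
  refine (integral_mono_ae (integrable_bhattacharyya_integrand (sup_le hm₁ hm₂) (hX₁.add hX₂))
    ((i₁.add i₂).sub i₃) ?_).trans_eq (integral_sub (i₁.add i₂) i₃)
  filter_upwards [condProb_add hm₁ hm₂ hX₁ hX₂ h 0, condProb_add hm₁ hm₂ hX₁ hX₂ h 1,
    condProb_nonneg hm₁ hX₁, condProb_nonneg hm₂ hX₂, condProb_add_eq_one hm₁ hX₁,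
    condProb_add_eq_one hm₂ hX₂] with ω e₀ e₁ n₁ n₂ s₁ s₂
  rw [e₀, e₁, zero_add, show (1 : ZMod 2) + 1 = 0 from rfl]
  exact two_mul_sqrt_convolution_le (n₁ 0) (n₁ 1) (n₂ 0) (n₂ 1) s₁ s₂

/-- The plus transform. -/
lemma bhattacharyya_sup_add_le (hm₁ : m₁ ≤ mΩ) (hm₂ : m₂ ≤ mΩ) (hX₁ : Measurable X₁)
    (hX₂ : Measurable X₂)
    (h : Indep (m₁ ⊔ .comap X₁ inferInstance) (m₂ ⊔ .comap X₂ inferInstance) μ) :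
    bhattacharyya μ ((m₁ ⊔ m₂) ⊔ .comap (X₁ + X₂) inferInstance) X₂ ≤
      bhattacharyya μ m₁ X₁ * bhattacharyya μ m₂ X₂ := by
  have hm : m₁ ⊔ m₂ ≤ mΩ := sup_le hm₁ hm₂
  have hm' : (m₁ ⊔ m₂) ⊔ .comap (X₁ + X₂) inferInstance ≤ mΩ :=
    sup_le hm (hX₁.add hX₂).comap_le
  set m' := (m₁ ⊔ m₂) ⊔ .comap (X₁ + X₂) inferInstance with hm'_def
  -- Joint events replace conditioning on `X₁ + X₂ = u`, so no division by its probability occurs.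
  let J : ZMod 2 → ZMod 2 → Set Ω := fun u x => (X₁ + X₂) ⁻¹' {u} ∩ X₂ ⁻¹' {x}
  have hJ : ∀ u x, J u x = X₁ ⁻¹' {u + x} ∩ X₂ ⁻¹' {x} := by
    intro u x
    ext ω
    simp only [J, Set.mem_inter_iff, Set.mem_preimage, Pi.add_apply, Set.mem_singleton_iff]
    generalize X₁ ω = a
    generalize X₂ ω = b
    revert a b u x
    decide
  have hJm : ∀ u x, MeasurableSet[mΩ] (J u x) := fun u x =>
    ((hX₁.add hX₂) (measurableSet_singleton u)).inter (hX₂ (measurableSet_singleton x))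
  have hJi : ∀ u x, ∀ᵐ ω ∂μ, 0 ≤ (μ⟦J u x | m'⟧) ω ∧ (μ⟦J u x | m'⟧) ω ≤ 1 := fun u x =>
    condExp_indicator_mem_Icc hm' (hJm u x)
  have hsq : ∀ u, Integrable (fun ω => √((μ⟦J u 0 | m'⟧) ω * (μ⟦J u 1 | m'⟧) ω)) μ := fun u =>
    integrable_sqrt_mul integrable_condExp.aestronglyMeasurable
      integrable_condExp.aestronglyMeasurable (hJi u 0) (hJi u 1)
  have hq : ∀ u x, μ⟦J u x | m'⟧ =ᵐ[μ] ((X₁ + X₂) ⁻¹' {u}).indicator (condProb μ m' X₂ x) := by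
    intro u x
    have hu : MeasurableSet[m'] ((X₁ + X₂) ⁻¹' {u}) :=
      le_sup_right (a := m₁ ⊔ m₂) _ ⟨{u}, measurableSet_singleton u, rfl⟩
    have := condExp_indicator (μ := μ) (m := m')
      ((integrable_const (1 : ℝ)).indicator (hX₂ (measurableSet_singleton x))) hu
    rwa [Set.indicator_indicator] at this
  -- Forgetting `X₁ + X₂` can only increase the integral, and over `m₁ ⊔ m₂` the probabilities
  -- factor. The `4` collects the two factors `2` in the parameters; the final sum over `u` and its
  -- factor `2` cancel it.
  have hle : ∀ u, ∫ ω, √((μ⟦J u 0 | m'⟧) ω * (μ⟦J u 1 | m'⟧) ω) ∂μ ≤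
      bhattacharyya μ m₁ X₁ * bhattacharyya μ m₂ X₂ / 4 := by
    intro u
    refine (integral_sqrt_mul_le hm integrable_condExp integrable_condExp
      (hJi u 0) (hJi u 1)).trans_eq ?_
    rw [← integral_bhattacharyya_mul hm₁ hm₂ hX₁ hX₂ h, ← integral_div]
    refine integral_congr_ae ?_
    have e : ∀ x, μ[μ⟦J u x | m'⟧ | m₁ ⊔ m₂] =ᵐ[μ]
        fun ω => condProb μ m₁ X₁ (u + x) ω * condProb μ m₂ X₂ x ω := fun x => by
      refine (condExp_condExp_of_le le_sup_left hm').trans ?_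
      rw [hJ]
      exact condExp_inter_preimage hm₁ hm₂ hX₁ hX₂ h _ _
    filter_upwards [e 0, e 1, condProb_nonneg hm₁ hX₁] with ω e₀ e₁ n₁
    have hu : condProb μ m₁ X₁ (u + 0) ω * condProb μ m₁ X₁ (u + 1) ω =
        condProb μ m₁ X₁ 0 ω * condProb μ m₁ X₁ 1 ω := by
      rcases eq_zero_or_eq_one u with rfl | rfl
      · simp
      · rw [add_zero, show (1 : ZMod 2) + 1 = 0 from rfl, mul_comm]
    rw [e₀, e₁, mul_mul_mul_comm, hu, Real.sqrt_mul (mul_nonneg (n₁ 0) (n₁ 1))]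
    ring
  calc bhattacharyya μ m' X₂
      = 2 * ∫ ω, (√((μ⟦J 0 0 | m'⟧) ω * (μ⟦J 0 1 | m'⟧) ω) +
          √((μ⟦J 1 0 | m'⟧) ω * (μ⟦J 1 1 | m'⟧) ω)) ∂μ := by
        rw [bhattacharyya, ← integral_const_mul]
        refine integral_congr_ae ?_
        filter_upwards [hq 0 0, hq 0 1, hq 1 0, hq 1 1] with ω h1 h2 h3 h4
        rw [h1, h2, h3, h4]
        rcases eq_zero_or_eq_one ((X₁ + X₂) ω) with h | h <;> simp [Set.indicator, h, -Pi.add_apply]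
    _ ≤ _ := by
        rw [integral_add (hsq 0) (hsq 1)]
        linarith [hle 0, hle 1]

end

/-! ### Passage to joint laws -/

/-- Removes the underlying space from the parameter. The conditional distribution is that of the
bit, so `𝓨` may be an arbitrary measurable space. -/
lemma bhattacharyya_eq_integral_condDistrib {Ω 𝓨 : Type*} [MeasurableSpace Ω] [MeasurableSpace 𝓨]
    {μ : Measure Ω} [IsFiniteMeasure μ] {X : Ω → ZMod 2} {Y : Ω → 𝓨} (hX : Measurable X)
    (hY : Measurable Y) :
    bhattacharyya μ (.comap Y inferInstance) X = ∫ y, 2 * √((condDistrib X Y μ y).real {0} *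
      (condDistrib X Y μ y).real {1}) ∂(μ.map Y) := by
  have hm : ∀ x, Measurable fun y => (condDistrib X Y μ y).real {x} := fun x =>
    ((condDistrib X Y μ).measurable_coe (measurableSet_singleton x)).ennreal_toReal
  have hm' : Measurable fun y => 2 * √((condDistrib X Y μ y).real {0} *
      (condDistrib X Y μ y).real {1}) := ((hm 0).mul (hm 1)).sqrt.const_mul 2
  rw [integral_map hY.aemeasurable hm'.aestronglyMeasurable]
  refine integral_congr_ae ?_
  filter_upwards [condDistrib_ae_eq_condExp (μ := μ) hY hX (measurableSet_singleton 0),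
    condDistrib_ae_eq_condExp (μ := μ) hY hX (measurableSet_singleton 1)] with ω h0 h1
  rw [h0, h1]
  rfl

/-- The Bhattacharyya parameter depends only on the joint law. -/
lemma bhattacharyya_eq_of_map_eq {Ω Ω' 𝓨 : Type*} [MeasurableSpace Ω] [MeasurableSpace Ω']
    [MeasurableSpace 𝓨] {μ : Measure Ω} [IsFiniteMeasure μ] {μ' : Measure Ω'} [IsFiniteMeasure μ']
    {X : Ω → ZMod 2} {Y : Ω → 𝓨} {X' : Ω' → ZMod 2} {Y' : Ω' → 𝓨} (hX : Measurable X)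
    (hY : Measurable Y) (hX' : Measurable X') (hY' : Measurable Y')
    (h : μ.map (fun ω => (Y ω, X ω)) = μ'.map (fun ω => (Y' ω, X' ω))) :
    bhattacharyya μ (.comap Y inferInstance) X = bhattacharyya μ' (.comap Y' inferInstance) X' := by
  have hfst : μ.map Y = μ'.map Y' := by
    have := congrArg Measure.fst h
    rwa [Measure.fst_map_prodMk hX, Measure.fst_map_prodMk hX'] at this
  have hcond : condDistrib X Y μ = condDistrib X' Y' μ' := by
    simp only [condDistrib, h]
  rw [bhattacharyya_eq_integral_condDistrib hX hY, bhattacharyya_eq_integral_condDistrib hX' hY',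
    hfst, hcond]

universe u

section
variable {𝓨 : Type u} [MeasurableSpace 𝓨]

/-- The Bhattacharyya parameter of a joint law of side information and bit. -/
noncomputable def lawBhattacharyya (ρ : Measure (𝓨 × ZMod 2)) : ℝ :=
  bhattacharyya ρ (.comap Prod.fst inferInstance) Prod.snd

/-- The joint law of `X₁ + X₂` and the side information `(Y₁, Y₂)`. -/
noncomputable def minusLaw (ρ : Measure (𝓨 × ZMod 2)) : Measure ((𝓨 × 𝓨) × ZMod 2) :=
  (ρ.prod ρ).map fun z => ((z.1.1, z.2.1), z.1.2 + z.2.2)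

/-- The joint law of `X₂` and the side information `(Y₁, Y₂, X₁ + X₂)`. -/
noncomputable def plusLaw (ρ : Measure (𝓨 × ZMod 2)) : Measure (((𝓨 × 𝓨) × ZMod 2) × ZMod 2) :=
  (ρ.prod ρ).map fun z => (((z.1.1, z.2.1), z.1.2 + z.2.2), z.2.2)

lemma bhattacharyya_eq_lawBhattacharyya {Ω : Type*} [MeasurableSpace Ω] {μ : Measure Ω}
    [IsFiniteMeasure μ] {X : Ω → ZMod 2} {Y : Ω → 𝓨} (hX : Measurable X) (hY : Measurable Y) :
    bhattacharyya μ (.comap Y inferInstance) X =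
      lawBhattacharyya (μ.map fun ω => (Y ω, X ω)) :=
  bhattacharyya_eq_of_map_eq hX hY measurable_snd measurable_fst Measure.map_id.symm

lemma lawBhattacharyya_nonneg (ρ : Measure (𝓨 × ZMod 2)) : 0 ≤ lawBhattacharyya ρ :=
  bhattacharyya_nonneg

variable (ρ : Measure (𝓨 × ZMod 2)) [IsProbabilityMeasure ρ]

lemma measurable_minusMap : Measurable fun z : (𝓨 × ZMod 2) × (𝓨 × ZMod 2) =>
    ((z.1.1, z.2.1), z.1.2 + z.2.2) := by fun_prop

lemma measurable_plusMap : Measurable fun z : (𝓨 × ZMod 2) × (𝓨 × ZMod 2) =>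
    (((z.1.1, z.2.1), z.1.2 + z.2.2), z.2.2) := by fun_prop

instance : IsProbabilityMeasure (minusLaw ρ) :=
  Measure.isProbabilityMeasure_map measurable_minusMap.aemeasurable

instance : IsProbabilityMeasure (plusLaw ρ) :=
  Measure.isProbabilityMeasure_map measurable_plusMap.aemeasurable

lemma lawBhattacharyya_le_one : lawBhattacharyya ρ ≤ 1 :=
  bhattacharyya_le_one measurable_fst.comap_le measurable_snd

lemma indep_prod_comap : Indep
    (.comap (fun z : (𝓨 × ZMod 2) × (𝓨 × ZMod 2) => z.1.1) inferInstance ⊔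
      .comap (fun z => z.1.2) inferInstance)
    (.comap (fun z => z.2.1) inferInstance ⊔ .comap (fun z => z.2.2) inferInstance)
    (ρ.prod ρ) := by
  rw [← MeasurableSpace.comap_prodMk, ← MeasurableSpace.comap_prodMk]
  exact (IndepFun_iff_Indep _ _ _).1 (indepFun_prod measurable_id measurable_id)

lemma bhattacharyya_fst : bhattacharyya (ρ.prod ρ)
    (.comap (fun z => z.1.1) inferInstance) (fun z => z.1.2) = lawBhattacharyya ρ := by
  rw [bhattacharyya_eq_lawBhattacharyya (by fun_prop) (by fun_prop)]
  exact congrArg _ Measure.fst_prod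

lemma bhattacharyya_snd : bhattacharyya (ρ.prod ρ)
    (.comap (fun z => z.2.1) inferInstance) (fun z => z.2.2) = lawBhattacharyya ρ := by
  rw [bhattacharyya_eq_lawBhattacharyya (by fun_prop) (by fun_prop)]
  exact congrArg _ Measure.snd_prod

lemma lawBhattacharyya_minusLaw_le :
    lawBhattacharyya (minusLaw ρ) ≤ 2 * lawBhattacharyya ρ - lawBhattacharyya ρ ^ 2 := by
  have h := bhattacharyya_add_le (μ := ρ.prod ρ)
    (Measurable.comap_le (by fun_prop)) (Measurable.comap_le (by fun_prop))
    (by fun_prop) (by fun_prop) (indep_prod_comap ρ)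
  rw [← MeasurableSpace.comap_prodMk, bhattacharyya_fst, bhattacharyya_snd,
    bhattacharyya_eq_lawBhattacharyya (by fun_prop) (by fun_prop)] at h
  exact h.trans_eq (by ring)

lemma lawBhattacharyya_plusLaw_le :
    lawBhattacharyya (plusLaw ρ) ≤ lawBhattacharyya ρ ^ 2 := by
  have h := bhattacharyya_sup_add_le (μ := ρ.prod ρ)
    (Measurable.comap_le (by fun_prop)) (Measurable.comap_le (by fun_prop))
    (by fun_prop) (by fun_prop) (indep_prod_comap ρ)
  rw [← MeasurableSpace.comap_prodMk, ← MeasurableSpace.comap_prodMk, bhattacharyya_fst,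
    bhattacharyya_snd, bhattacharyya_eq_lawBhattacharyya (by fun_prop) (by fun_prop)] at h
  exact h.trans_eq (sq _).symm

end

/-! ### Averages over the polarization tree -/

/-- The average of `φ` over the Bhattacharyya parameters of the `2 ^ n` laws obtained by `n`-fold
application of the two transforms. -/
noncomputable def polarAverage (φ : ℝ → ℝ) :
    (n : ℕ) → {𝓨 : Type u} → [MeasurableSpace 𝓨] → Measure (𝓨 × ZMod 2) → ℝ
  | 0, _, _, ρ => φ (lawBhattacharyya ρ)
  | n + 1, _, _, ρ => (polarAverage φ n (minusLaw ρ) + polarAverage φ n (plusLaw ρ)) / 2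

lemma polarAverage_mem_Icc {φ : ℝ → ℝ} {a b : ℝ}
    (hφ : ∀ z, 0 ≤ z → z ≤ 1 → a ≤ φ z ∧ φ z ≤ b) (n : ℕ) :
    ∀ {𝓨 : Type u} [MeasurableSpace 𝓨] (ρ : Measure (𝓨 × ZMod 2)) [IsProbabilityMeasure ρ],
      a ≤ polarAverage φ n ρ ∧ polarAverage φ n ρ ≤ b := by
  induction n with
  | zero => exact fun ρ _ => hφ _ (lawBhattacharyya_nonneg ρ) (lawBhattacharyya_le_one ρ)
  | succ n ih =>
    intro 𝓨 _ ρ _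
    have h1 := ih (minusLaw ρ)
    have h2 := ih (plusLaw ρ)
    simp only [polarAverage]
    constructor <;> linarith

/-- The gain in `(1 - z)²` at a single node is at least `(z(1 - z))²`; averaging over the nodes of
level `n` gives the claim. -/
lemma polarAverage_add_le (n : ℕ) :
    ∀ {𝓨 : Type u} [MeasurableSpace 𝓨] (ρ : Measure (𝓨 × ZMod 2)) [IsProbabilityMeasure ρ],
      polarAverage (fun z => (1 - z) ^ 2) n ρ + polarAverage (fun z => (z * (1 - z)) ^ 2) n ρ ≤
        polarAverage (fun z => (1 - z) ^ 2) (n + 1) ρ := by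
  induction n with
  | zero =>
    intro 𝓨 _ ρ _
    simp only [polarAverage]
    have h1 := lawBhattacharyya_minusLaw_le ρ
    have h2 := lawBhattacharyya_plusLaw_le ρ
    have h0 := lawBhattacharyya_nonneg ρ
    have h3 := lawBhattacharyya_le_one ρ
    set z := lawBhattacharyya ρ
    have e1 : ((1 - z) ^ 2) ^ 2 ≤ (1 - lawBhattacharyya (minusLaw ρ)) ^ 2 := by
      gcongr
      linarith
    have e2 : (1 - z ^ 2) ^ 2 ≤ (1 - lawBhattacharyya (plusLaw ρ)) ^ 2 := by
      have : 0 ≤ 1 - z ^ 2 := by nlinarith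
      gcongr
    have e3 : ((1 - z) ^ 2) ^ 2 + (1 - z ^ 2) ^ 2 = 2 * ((1 - z) ^ 2 + (z * (1 - z)) ^ 2) := by ring
    linarith
  | succ n ih =>
    intro 𝓨 _ ρ _
    have h1 := ih (minusLaw ρ)
    have h2 := ih (plusLaw ρ)
    rw [polarAverage, polarAverage, polarAverage]
    linarith

/-- A bounded increasing sequence has increments tending to `0`, and they dominate these averages.
-/
lemma tendsto_polarAverage {𝓨 : Type u} [MeasurableSpace 𝓨] (ρ : Measure (𝓨 × ZMod 2))
    [IsProbabilityMeasure ρ] :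
    Tendsto (fun n => polarAverage (fun z => (z * (1 - z)) ^ 2) n ρ) atTop (𝓝 0) := by
  have h0 : ∀ n, 0 ≤ polarAverage (fun z => (z * (1 - z)) ^ 2) n ρ := fun n =>
    (polarAverage_mem_Icc (b := 1) (fun z h0 h1 => ⟨sq_nonneg _,
      pow_le_one₀ (mul_nonneg h0 (sub_nonneg.2 h1)) (by nlinarith)⟩) n ρ).1
  have h1 : ∀ n, polarAverage (fun z => (1 - z) ^ 2) n ρ ≤ 1 := fun n =>
    (polarAverage_mem_Icc (a := 0) (fun z h0 h1 => ⟨sq_nonneg _,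
      pow_le_one₀ (sub_nonneg.2 h1) (by linarith)⟩) n ρ).2
  have hmono : Monotone fun n => polarAverage (fun z => (1 - z) ^ 2) n ρ :=
    monotone_nat_of_le_succ fun n => by linarith [h0 n, polarAverage_add_le n ρ]
  obtain ⟨l, hl⟩ := tendsto_atTop_of_monotone hmono |>.resolve_left fun h => by
    obtain ⟨n, hn⟩ := (h.eventually_gt_atTop 1).exists
    exact (h1 n).not_gt hn
  have hd := ((tendsto_add_atTop_iff_nat 1).2 hl).sub hl
  rw [sub_self] at hd
  exact squeeze_zero h0 (fun n => by linarith [polarAverage_add_le n ρ]) hd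

/-! ### Recursive structure of the polar matrix -/

/-- The lexicographic indexing used in `polarMatrix`. -/
def blockEquiv (n : ℕ) : Fin 2 × Fin (2 ^ n) ≃ Fin (2 ^ (n + 1)) :=
  finProdFinEquiv.trans (finCongr (pow_succ' 2 n).symm)

lemma polarMatrix_succ (n : ℕ) : polarMatrix (n + 1) =
    Matrix.reindex (blockEquiv n) (blockEquiv n) (kernelMatrix ⊗ₖ polarMatrix n) := rfl

/-- In characteristic two the kernel is an involution. This lets the inputs of a block be recovered
from all its outputs. -/
lemma polarMatrix_mul_self (n : ℕ) : polarMatrix n * polarMatrix n = 1 := by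
  induction n with
  | zero => simp [polarMatrix]
  | succ n ih =>
    have hk : kernelMatrix * kernelMatrix = 1 := by decide
    rw [polarMatrix_succ, Matrix.reindex_apply, Matrix.submatrix_mul_equiv,
      ← Matrix.mul_kronecker_mul, ih, hk, Matrix.one_kronecker_one, Matrix.submatrix_one_equiv]

lemma val_blockEquiv (n : ℕ) (a : Fin 2) (j : Fin (2 ^ n)) :
    (blockEquiv n (a, j) : ℕ) = j + 2 ^ n * a := by
  simp [blockEquiv]

lemma blockEquiv_lt_blockEquiv {n : ℕ} {a b : Fin 2} {i j : Fin (2 ^ n)} :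
    blockEquiv n (a, i) < blockEquiv n (b, j) ↔ a < b ∨ a = b ∧ i < j := by
  rw [Fin.lt_def, val_blockEquiv, val_blockEquiv]
  have hi := i.2
  have hj := j.2
  fin_cases a <;> fin_cases b <;> simp <;> omega

section
variable {Ω : Type*} {n : ℕ}

lemma output_zero (X : Fin (2 ^ 0) → Ω → ZMod 2) (i : Fin (2 ^ 0)) : output X i = X i := by
  ext ω
  simp [output, polarMatrix]

lemma output_output (X : Fin (2 ^ n) → Ω → ZMod 2) : output (output X) = X := by
  ext i ω
  change Matrix.vecMul (Matrix.vecMul (fun j => X j ω) (polarMatrix n)) (polarMatrix n) i = _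
  rw [Matrix.vecMul_vecMul, polarMatrix_mul_self, Matrix.vecMul_one]

lemma output_eq_sum (X : Fin (2 ^ n) → Ω → ZMod 2) (i : Fin (2 ^ n)) :
    output X i = fun ω => ∑ j, X j ω * polarMatrix n j i := rfl

lemma output_blockEquiv (X : Fin (2 ^ (n + 1)) → Ω → ZMod 2) (b : Fin 2) (i : Fin (2 ^ n)) :
    output X (blockEquiv n (b, i)) =
      output (fun j => fun ω => X (blockEquiv n (0, j)) ω * kernelMatrix 0 b +
        X (blockEquiv n (1, j)) ω * kernelMatrix 1 b) i := by
  ext ω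
  rw [output_eq_sum, output_eq_sum]
  simp only [polarMatrix_succ, Matrix.reindex_apply, Matrix.submatrix_apply, Equiv.symm_apply_apply]
  rw [← (blockEquiv n).sum_comp, Fintype.sum_prod_type, Fin.sum_univ_two, ← Finset.sum_add_distrib]
  refine Finset.sum_congr rfl fun j _ => ?_
  simp only [Equiv.symm_apply_apply, Matrix.kroneckerMap_apply]
  ring

lemma output_blockEquiv_zero (X : Fin (2 ^ (n + 1)) → Ω → ZMod 2) (i : Fin (2 ^ n)) :
    output X (blockEquiv n (0, i)) =
      output (fun j => X (blockEquiv n (0, j)) + X (blockEquiv n (1, j))) i := by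
  rw [output_blockEquiv]
  congr
  ext j ω
  simp [kernelMatrix]

lemma output_blockEquiv_one (X : Fin (2 ^ (n + 1)) → Ω → ZMod 2) (i : Fin (2 ^ n)) :
    output X (blockEquiv n (1, i)) = output (fun j => X (blockEquiv n (1, j))) i := by
  rw [output_blockEquiv]
  congr
  ext j ω
  simp [kernelMatrix]

lemma measurable_output {σ : MeasurableSpace Ω} {X : Fin (2 ^ n) → Ω → ZMod 2}
    (h : ∀ j, Measurable[σ] (X j)) (i : Fin (2 ^ n)) : Measurable[σ] (output X i) := by
  rw [output_eq_sum]
  exact Finset.measurable_fun_sum _ fun j _ => (h j).mul_const _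

variable {𝓨 : Type*} [MeasurableSpace 𝓨]

/-- Allows σ-algebras of side information to be compared one coordinate at a time. -/
lemma comap_outputSide_le_iff {σ : MeasurableSpace Ω} {X : Fin (2 ^ n) → Ω → ZMod 2}
    {Y : Fin (2 ^ n) → Ω → 𝓨} {i : Fin (2 ^ n)} :
    MeasurableSpace.comap (outputSide X Y i) inferInstance ≤ σ ↔
      (∀ j < i, Measurable[σ] (output X j)) ∧ ∀ j, Measurable[σ] (Y j) := by
  rw [← measurable_iff_comap_le]
  constructor
  · intro h
    exact ⟨fun j hj => (measurable_pi_apply (⟨j, hj⟩ : {j // j < i})).comp (measurable_fst.comp h),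
      fun j => (measurable_pi_apply j).comp (measurable_snd.comp h)⟩
  · rintro ⟨h1, h2⟩
    exact (measurable_pi_lambda _ fun j : {j // j < i} => h1 j.1 j.2).prodMk (measurable_pi_lambda _ h2)

lemma measurable_outputSide [MeasurableSpace Ω] {X : Fin (2 ^ n) → Ω → ZMod 2}
    {Y : Fin (2 ^ n) → Ω → 𝓨} (hX : ∀ i, Measurable (X i)) (hY : ∀ i, Measurable (Y i))
    (i : Fin (2 ^ n)) : Measurable (outputSide X Y i) :=
  measurable_iff_comap_le.2
    (comap_outputSide_le_iff.2 ⟨fun j _ => measurable_output hX j, hY⟩)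

lemma comap_outputSide_blockEquiv_zero (X : Fin (2 ^ (n + 1)) → Ω → ZMod 2)
    (Y : Fin (2 ^ (n + 1)) → Ω → 𝓨) (i : Fin (2 ^ n)) :
    MeasurableSpace.comap (outputSide X Y (blockEquiv n (0, i))) inferInstance =
      MeasurableSpace.comap (outputSide
        (fun j => X (blockEquiv n (0, j)) + X (blockEquiv n (1, j)))
        (fun j ω => (Y (blockEquiv n (0, j)) ω, Y (blockEquiv n (1, j)) ω)) i) inferInstance := by
  apply le_antisymm
  · obtain ⟨h1, h2⟩ := comap_outputSide_le_iff.1 (le_refl (MeasurableSpace.comap (outputSide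
        (fun j => X (blockEquiv n (0, j)) + X (blockEquiv n (1, j)))
        (fun j ω => (Y (blockEquiv n (0, j)) ω, Y (blockEquiv n (1, j)) ω)) i) inferInstance))
    rw [comap_outputSide_le_iff]
    refine ⟨fun k hk => ?_, fun k => ?_⟩
    · obtain ⟨⟨a, j⟩, rfl⟩ := (blockEquiv n).surjective k
      rcases blockEquiv_lt_blockEquiv.1 hk with h | ⟨rfl, h⟩
      · exact absurd h (Fin.not_lt_zero a)
      · rw [output_blockEquiv_zero]
        exact h1 j h
    · obtain ⟨⟨a, j⟩, rfl⟩ := (blockEquiv n).surjective k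
      fin_cases a
      · exact measurable_fst.comp (h2 j)
      · exact measurable_snd.comp (h2 j)
  · obtain ⟨h1, h2⟩ := comap_outputSide_le_iff.1
      (le_refl (MeasurableSpace.comap (outputSide X Y (blockEquiv n (0, i))) inferInstance))
    rw [comap_outputSide_le_iff]
    refine ⟨fun j hj => ?_, fun j => (h2 _).prodMk (h2 _)⟩
    rw [← output_blockEquiv_zero]
    exact h1 _ (blockEquiv_lt_blockEquiv.2 (Or.inr ⟨rfl, hj⟩))

/-- Every output of the first half precedes an index of the second half. Those outputs carry the
same information as the sums of paired inputs, which is the extra side information of the plus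
transform. -/
lemma comap_outputSide_blockEquiv_one (X : Fin (2 ^ (n + 1)) → Ω → ZMod 2)
    (Y : Fin (2 ^ (n + 1)) → Ω → 𝓨) (i : Fin (2 ^ n)) :
    MeasurableSpace.comap (outputSide X Y (blockEquiv n (1, i))) inferInstance =
      MeasurableSpace.comap (outputSide (fun j => X (blockEquiv n (1, j)))
        (fun j ω => ((Y (blockEquiv n (0, j)) ω, Y (blockEquiv n (1, j)) ω),
          X (blockEquiv n (0, j)) ω + X (blockEquiv n (1, j)) ω)) i) inferInstance := by
  apply le_antisymm
  · obtain ⟨h1, h2⟩ := comap_outputSide_le_iff.1 (le_refl (MeasurableSpace.comap (outputSide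
        (fun j => X (blockEquiv n (1, j)))
        (fun j ω => ((Y (blockEquiv n (0, j)) ω, Y (blockEquiv n (1, j)) ω),
          X (blockEquiv n (0, j)) ω + X (blockEquiv n (1, j)) ω)) i) inferInstance))
    rw [comap_outputSide_le_iff]
    refine ⟨fun k hk => ?_, fun k => ?_⟩
    · obtain ⟨⟨a, j⟩, rfl⟩ := (blockEquiv n).surjective k
      rcases blockEquiv_lt_blockEquiv.1 hk with h | ⟨rfl, h⟩
      · obtain rfl : a = 0 := by omega
        rw [output_blockEquiv_zero]
        exact measurable_output (fun j => measurable_snd.comp (h2 j)) j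
      · rw [output_blockEquiv_one]
        exact h1 j h
    · obtain ⟨⟨a, j⟩, rfl⟩ := (blockEquiv n).surjective k
      fin_cases a
      · exact measurable_fst.comp (measurable_fst.comp (h2 j))
      · exact measurable_snd.comp (measurable_fst.comp (h2 j))
  · obtain ⟨h1, h2⟩ := comap_outputSide_le_iff.1
      (le_refl (MeasurableSpace.comap (outputSide X Y (blockEquiv n (1, i))) inferInstance))
    rw [comap_outputSide_le_iff]
    refine ⟨fun j hj => ?_, fun j => ((h2 _).prodMk (h2 _)).prodMk ?_⟩
    · rw [← output_blockEquiv_one]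
      exact h1 _ (blockEquiv_lt_blockEquiv.2 (Or.inr ⟨rfl, hj⟩))
    · have h3 : ∀ j, Measurable[MeasurableSpace.comap
          (outputSide X Y (blockEquiv n (1, i))) inferInstance]
          (output (fun j => X (blockEquiv n (0, j)) + X (blockEquiv n (1, j))) j) := fun j => by
        rw [← output_blockEquiv_zero]
        exact h1 _ (blockEquiv_lt_blockEquiv.2 (Or.inl Fin.zero_lt_one))
      -- Applying the transform a second time inverts it.
      have h4 : Measurable[MeasurableSpace.comap
          (outputSide X Y (blockEquiv n (1, i))) inferInstance]
          (output (output fun j => X (blockEquiv n (0, j)) + X (blockEquiv n (1, j))) j) :=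
        measurable_output h3 j
      rw [output_output] at h4
      exact h4

end

/-! ### Pairing inputs and identifying the output parameters -/

/-- Joining independent `σ`-algebras in pairs preserves independence. -/
lemma iIndep_sup_of_iIndep {Ω ι : Type*} {mΩ : MeasurableSpace Ω} {μ : Measure Ω}
    {m : Fin 2 × ι → MeasurableSpace Ω} (hm : ∀ k, m k ≤ mΩ) (h : iIndep m μ) :
    iIndep (fun i => m (0, i) ⊔ m (1, i)) μ := by
  refine iIndepSets.iIndep (fun i => sup_le (hm _) (hm _)) _
    (fun i => isPiSystem_image2_inter (m (0, i)) (m (1, i)))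
    (fun i => generateFrom_image2_inter _ _) ?_
  rw [iIndepSets_iff]
  intro s f hf
  classical
  have hf' : ∀ i, ∃ C : Fin 2 → Set Ω, i ∈ s →
      (∀ a, MeasurableSet[m (a, i)] (C a)) ∧ f i = C 0 ∩ C 1 := by
    intro i
    by_cases hi : i ∈ s
    · obtain ⟨A, hA, B, hB, hAB⟩ := hf i hi
      refine ⟨![A, B], fun _ => ⟨fun a => ?_, hAB.symm⟩⟩
      fin_cases a
      exacts [hA, hB]
    · exact ⟨fun _ => ∅, fun h => absurd h hi⟩
  choose C hC using hf'
  -- Stated for every subset so that singletons identify each factor as `μ (f i)`.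
  have hprod : ∀ t ⊆ s, μ (⋂ i ∈ t, f i) = ∏ i ∈ t, (μ (C i 0) * μ (C i 1)) := by
    intro t ht
    have e : ⋂ i ∈ t, f i = ⋂ k ∈ (Finset.univ : Finset (Fin 2)) ×ˢ t, C k.2 k.1 := by
      ext ω
      simp only [Set.mem_iInter, Finset.mem_product, Finset.mem_univ, true_and, Prod.forall,
        Fin.forall_fin_two]
      constructor
      · exact fun h => ⟨fun i hi => ((hC i (ht hi)).2 ▸ h i hi).1,
          fun i hi => ((hC i (ht hi)).2 ▸ h i hi).2⟩
      · exact fun h i hi => (hC i (ht hi)).2 ▸ ⟨h.1 i hi, h.2 i hi⟩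
    rw [e, h.meas_biInter (s := fun k => C k.2 k.1), Finset.prod_product_right]
    · simp [Fin.prod_univ_two]
    · intro k hk
      exact (hC k.2 (ht (Finset.mem_product.1 hk).2)).1 k.1
  rw [hprod s subset_rfl]
  refine Finset.prod_congr rfl fun i hi => ?_
  have := hprod {i} (by simpa using hi)
  simpa using this.symm

section
variable {Ω 𝓨 : Type*} [mΩ : MeasurableSpace Ω] [MeasurableSpace 𝓨] {n : ℕ}
  {X : Fin (2 ^ (n + 1)) → Ω → ZMod 2} {Y : Fin (2 ^ (n + 1)) → Ω → 𝓨}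

/-- The two data elements combined by the first stage of the polar transform. -/
def blockPair (X : Fin (2 ^ (n + 1)) → Ω → ZMod 2) (Y : Fin (2 ^ (n + 1)) → Ω → 𝓨)
    (i : Fin (2 ^ n)) : Ω → (𝓨 × ZMod 2) × (𝓨 × ZMod 2) :=
  fun ω => ((Y (blockEquiv n (0, i)) ω, X (blockEquiv n (0, i)) ω),
    (Y (blockEquiv n (1, i)) ω, X (blockEquiv n (1, i)) ω))

lemma measurable_blockPair (hX : ∀ i, Measurable (X i)) (hY : ∀ i, Measurable (Y i))
    (i : Fin (2 ^ n)) : Measurable (blockPair X Y i) :=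
  ((hY _).prodMk (hX _)).prodMk ((hY _).prodMk (hX _))

variable {μ : Measure Ω}

lemma iIndepFun_blockPair (hX : ∀ i, Measurable (X i)) (hY : ∀ i, Measurable (Y i))
    (h : iIndepFun (fun i ω => (Y i ω, X i ω)) μ) : iIndepFun (blockPair X Y) μ := by
  rw [iIndepFun_iff_iIndep]
  have h' := (iIndepFun_iff_iIndep _ _ _).1 (h.precomp (blockEquiv n).injective)
  have := iIndep_sup_of_iIndep
    (fun k => ((hY (blockEquiv n k)).prodMk (hX (blockEquiv n k))).comap_le) h'
  simp only [← MeasurableSpace.comap_prodMk] at this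
  exact this

lemma map_blockPair [IsProbabilityMeasure μ] (hX : ∀ i, Measurable (X i))
    (hY : ∀ i, Measurable (Y i))
    (h : iIndepFun (fun i ω => (Y i ω, X i ω)) μ) {ρ : Measure (𝓨 × ZMod 2)}
    (hρ : ∀ i, μ.map (fun ω => (Y i ω, X i ω)) = ρ) (i : Fin (2 ^ n)) :
    μ.map (blockPair X Y i) = ρ.prod ρ := by
  have hne : blockEquiv n (0, i) ≠ blockEquiv n (1, i) := fun h => by
    simpa using (blockEquiv n).injective h
  have := (indepFun_iff_map_prod_eq_prod_map_map ((hY _).prodMk (hX _)).aemeasurable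
    ((hY _).prodMk (hX _)).aemeasurable).1 (h.indepFun hne)
  rwa [hρ, hρ] at this

end

/-- The outer factor `F` acts on the pairs `(j, j + 2 ^ n)`. The first half of the outputs is then a
transform of size `2 ^ n` on i.i.d. data of law `minusLaw ρ`, the second half one on i.i.d. data of
law `plusLaw ρ`. The halves depend on each other, but the sum only needs each separately. The side
information alphabet changes at each step, hence the quantification over `𝓨`. -/
lemma sum_bhattacharyya_output {Ω : Type*} [MeasurableSpace Ω] {μ : Measure Ω}
    [IsProbabilityMeasure μ] (φ : ℝ → ℝ) (n : ℕ) :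
    ∀ {𝓨 : Type u} [MeasurableSpace 𝓨] {ρ : Measure (𝓨 × ZMod 2)}
      {X : Fin (2 ^ n) → Ω → ZMod 2} {Y : Fin (2 ^ n) → Ω → 𝓨}, (∀ i, Measurable (X i)) →
      (∀ i, Measurable (Y i)) → iIndepFun (fun i ω => (Y i ω, X i ω)) μ →
      (∀ i, μ.map (fun ω => (Y i ω, X i ω)) = ρ) →
      ∑ i, φ (bhattacharyya μ (.comap (outputSide X Y i) inferInstance) (output X i)) =
        2 ^ n * polarAverage φ n ρ := by
  induction n with
  | zero =>
    intro 𝓨 _ ρ X Y hX hY _ hρ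
    have : Subsingleton (Fin (2 ^ 0)) := inferInstanceAs (Subsingleton (Fin 1))
    have hside : ∀ i, MeasurableSpace.comap (outputSide X Y i) inferInstance =
        MeasurableSpace.comap (Y i) inferInstance := by
      intro i
      apply le_antisymm
      · rw [comap_outputSide_le_iff]
        refine ⟨fun j hj => absurd hj (Subsingleton.elim j i ▸ lt_irrefl _), fun j => ?_⟩
        rw [Subsingleton.elim j i]
        exact comap_measurable _
      · rw [← measurable_iff_comap_le]
        exact (comap_outputSide_le_iff.1 le_rfl).2 i
    simp [hside, output_zero, fun i => bhattacharyya_eq_lawBhattacharyya (μ := μ) (hX i) (hY i), hρ,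
      polarAverage]
  | succ n ih =>
    intro 𝓨 _ ρ X Y hX hY hind hρ
    have hpair := iIndepFun_blockPair hX hY hind
    have hmap := map_blockPair hX hY hind hρ
    have hmeas := measurable_blockPair hX hY
    have hminus := ih (ρ := minusLaw ρ)
      (X := fun j => X (blockEquiv n (0, j)) + X (blockEquiv n (1, j)))
      (Y := fun j ω => (Y (blockEquiv n (0, j)) ω, Y (blockEquiv n (1, j)) ω))
      (fun j => (hX _).add (hX _)) (fun j => (hY _).prodMk (hY _))
      (hpair.comp _ fun _ => measurable_minusMap)
      (fun i => by
        rw [minusLaw, ← hmap i, Measure.map_map measurable_minusMap (hmeas i)]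
        rfl)
    have hplus := ih (ρ := plusLaw ρ)
      (X := fun j => X (blockEquiv n (1, j)))
      (Y := fun j ω => ((Y (blockEquiv n (0, j)) ω, Y (blockEquiv n (1, j)) ω),
          X (blockEquiv n (0, j)) ω + X (blockEquiv n (1, j)) ω))
      (fun j => hX _) (fun j => ((hY _).prodMk (hY _)).prodMk ((hX _).add (hX _)))
      (hpair.comp _ fun _ => measurable_plusMap)
      (fun i => by
        rw [plusLaw, ← hmap i, Measure.map_map measurable_plusMap (hmeas i)]
        rfl)
    rw [← (blockEquiv n).sum_comp, Fintype.sum_prod_type, Fin.sum_univ_two]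
    simp only [comap_outputSide_blockEquiv_zero, comap_outputSide_blockEquiv_one,
      output_blockEquiv_zero, output_blockEquiv_one]
    rw [hminus, hplus, polarAverage]
    ring

end Polar

/-! ### Conclusion -/

theorem theorem3
    {Ω₀ 𝓨 : Type*} [MeasurableSpace Ω₀] [MeasurableSpace 𝓨]
    (μ₀ : Measure Ω₀) [IsProbabilityMeasure μ₀]
    (X₀ : Ω₀ → ZMod 2) (Y₀ : Ω₀ → 𝓨) (hX₀ : Measurable X₀) (hY₀ : Measurable Y₀)
    {Ω : ℕ → Type*} [∀ n, MeasurableSpace (Ω n)]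
    (μ : ∀ n, Measure (Ω n)) [∀ n, IsProbabilityMeasure (μ n)]
    (X : ∀ n, Fin (2 ^ n) → Ω n → ZMod 2) (Y : ∀ n, Fin (2 ^ n) → Ω n → 𝓨)
    (hX : ∀ n i, Measurable (X n i)) (hY : ∀ n i, Measurable (Y n i))
    (hindep : ∀ n, iIndepFun (fun i ω => (X n i ω, Y n i ω)) (μ n))
    (hident : ∀ n i, IdentDistrib (fun ω => (X n i ω, Y n i ω))
      (fun ω => (X₀ ω, Y₀ ω)) (μ n) μ₀) :
    (∀ n i, MemLp
      (Polar.entropyRV (μ n) (Polar.output (X n) i) (Polar.outputSide (X n) (Y n) i))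
      2 (μ n)) ∧
    Tendsto (fun n : ℕ => (1 / (2 : ℝ) ^ n) * ∑ i : Fin (2 ^ n),
      Polar.varentropy (μ n) (Polar.output (X n) i) (Polar.outputSide (X n) (Y n) i))
      atTop (𝓝 0) := by
  have hU : ∀ n i, Measurable (Polar.output (X n) i) := fun n => Polar.measurable_output (hX n)
  have hS : ∀ n i, Measurable (Polar.outputSide (X n) (Y n) i) := fun n =>
    Polar.measurable_outputSide (hX n) (hY n)
  refine ⟨fun n i => Polar.memLp_entropyRV (hU n i) (hS n i), ?_⟩
  let ρ : Measure (𝓨 × ZMod 2) := μ₀.map fun ω => (Y₀ ω, X₀ ω)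
  have : IsProbabilityMeasure ρ := Measure.isProbabilityMeasure_map (hY₀.prodMk hX₀).aemeasurable
  have hρ : ∀ n i, (μ n).map (fun ω => (Y n i ω, X n i ω)) = ρ := fun n i =>
    ((hident n i).comp measurable_swap).map_eq
  have hind : ∀ n, iIndepFun (fun i ω => (Y n i ω, X n i ω)) (μ n) := fun n =>
    (hindep n).comp (fun _ => Prod.swap) fun _ => measurable_swap
  set C : ℝ := 32 / Real.log 2 ^ 2
  have hC : 0 ≤ C := by positivity
  have hlim := ((Polar.tendsto_polarAverage ρ).sqrt).const_mul C
  rw [Real.sqrt_zero, mul_zero] at hlim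
  refine squeeze_zero (fun n => ?_) (fun n => ?_) hlim
  · exact mul_nonneg (by positivity) (Finset.sum_nonneg fun i _ => Polar.varentropy_nonneg)
  have hV : ∀ i, Polar.varentropy (μ n) (Polar.output (X n) i) (Polar.outputSide (X n) (Y n) i) ≤
      C * _ := fun i => Polar.varentropy_le (hU n i) (hS n i)
  have hsum := Polar.sum_bhattacharyya_output (fun z => (z * (1 - z)) ^ 2) n (hX n) (hY n) (hind n)
    (hρ n)
  set z : Fin (2 ^ n) → ℝ := fun i => Polar.bhattacharyya (μ n)
    (.comap (Polar.outputSide (X n) (Y n) i) inferInstance) (Polar.output (X n) i)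
  -- Cauchy–Schwarz bounds the average of `z(1 - z)` by the square root of the average of its
  -- square.
  have hcs := sq_sum_le_card_mul_sum_sq (s := Finset.univ) (f := fun i => z i * (1 - z i))
  rw [hsum] at hcs
  simp only [Finset.card_univ, Fintype.card_fin, Nat.cast_pow, Nat.cast_ofNat] at hcs
  have hN : (0 : ℝ) < 2 ^ n := by positivity
  have hle : (1 / (2 : ℝ) ^ n) * ∑ i, z i * (1 - z i) ≤
      √(Polar.polarAverage (fun z => (z * (1 - z)) ^ 2) n ρ) := by
    apply Real.le_sqrt_of_sq_le
    rw [mul_pow, div_pow, one_pow, one_div, inv_mul_le_iff₀ (by positivity)]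
    exact hcs.trans_eq (by ring)
  calc (1 / (2 : ℝ) ^ n) * ∑ i, _ ≤ (1 / (2 : ℝ) ^ n) * ∑ i, C * (z i * (1 - z i)) := by
        gcongr with i
        exact hV i
    _ = C * ((1 / (2 : ℝ) ^ n) * ∑ i, z i * (1 - z i)) := by rw [← Finset.mul_sum]; ring
    _ ≤ _ := by gcongr
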